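/- Let $X$ be a locally noetherian affine non-commutative space with coordinate ring $R$; that is, $X$ is given by a Grothendieck category $\mathsf{Mod}\,X$ which has a set of noetherian generators and is equivalent to the category $\mathsf{Mod}\,R$ of right modules over the ring $R$. A weakly closed subspace $W$ of $X$ is a full subcategory $\mathsf{Mod}\,W\subseteq\mathsf{Mod}\,X$ that is closed under subobjects and quotients and whose inclusion functor has a right adjoint; it is closed if the inclusion functor also has a left adjoint. The support of a noetherian $X$-module $M$ is the smallest closed subspace $Z$ with $M\in\mathsf{Mod}\,Z$. The space $X$ has enough closed subspaces if, for every noetherian $X$-module $M$, the smallest weakly closed subspace $W$ with $M\in\mathsf{Mod}\,W$ is equal to the support of $M$. A non-zero right $R$-module is prime if all its non-zero submodules have the same annihilator. A (two-sided) prime ideal $P$ of $R$ is associated to a right $R$-module $E$ if $P=\operatorname{Ann}N$ for some prime submodule $N$ of $E$. The following are equivalent: 1. $X$ has enough closed subspaces; 2. (Gabriel's condition (H)) for every noetherian right $R$-module $M$ there are finitely many elements $m_1,\dots,m_n\in M$ with $\operatorname{Ann}M=\bigcap_{i=1}^n\operatorname{Ann}(m_i)$; 3. the relation "$P$ is associated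 to $E$" is a bijection between the set of prime ideals $P$ of $R$ and the set of isomorphism classes of indecomposable injective right $R$-modules $E$. -/

import Mathlib

open CategoryTheory MulOpposite

universe u v w

/-! ### Non-commutative spaces

A non-commutative space `X` is a Grothendieck category `C = Mod X`; a full subcategory of `C` is
given by a predicate on its objects (`ObjectProperty C`), and one subspace contains another when
the corresponding predicates do. -/

namespace NCSpace

section Category

variable (C : Type w) [Category.{v} C]

/-- `C` has a (small) set of noetherian generators. -/
def IsLocallyNoetherian : Prop :=
  ∃ P : ObjectProperty C, ObjectProperty.Small.{u} P ∧ P.IsSeparating ∧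
    ∀ G, P G → IsNoetherianObject G

variable {C}

/-- A weakly closed subspace: a full subcategory closed under subobjects and quotients (hence under
subquotients and isomorphisms) whose inclusion functor has a right adjoint. -/
structure IsWeaklyClosed (W : ObjectProperty C) : Prop where
  subobjects : W.IsClosedUnderSubobjects
  quotients : W.IsClosedUnderQuotients
  hasRightAdjoint : W.ι.IsLeftAdjoint

/-- A closed subspace: a weakly closed subspace whose inclusion functor also has a left adjoint. -/
structure IsClosed (Z : ObjectProperty C) : Prop extends IsWeaklyClosed Z where
  hasLeftAdjoint : Z.ι.IsRightAdjoint

/-- `Z` is the smallest weakly closed subspace that contains the module `M`. -/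
def IsWeakSupport (M : C) (Z : ObjectProperty C) : Prop :=
  IsLeast {W : ObjectProperty C | IsWeaklyClosed W ∧ W M} Z

/-- `Z` is the support of the module `M`: the smallest closed subspace that contains `M`. -/
def IsSupport (M : C) (Z : ObjectProperty C) : Prop :=
  IsLeast {W : ObjectProperty C | IsClosed W ∧ W M} Z

variable (C)

/-- Every noetherian module has a smallest weakly closed subspace containing it, and this is
the support of the module. -/
def HasEnoughClosedSubspaces : Prop :=
  ∀ M : C, IsNoetherianObject M → ∃ Z : ObjectProperty C, IsWeakSupport M Z ∧ IsSupport M Z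

end Category

/-! ### Right modules

A right `R`-module is a module over `Rᵐᵒᵖ`, where `m r` is written `op r • m`. -/

section Ring

variable (R : Type u) [Ring R]

/-- `R` is a coordinate ring of the space with module category `C` (which is then affine):
`C` is equivalent to the category of right `R`-modules. -/
def IsCoordinateRing (C : Type w) [Category.{v} C] : Prop :=
  Nonempty (C ≌ ModuleCat.{u} Rᵐᵒᵖ)

/-- Gabriel's condition (H): the annihilator of every noetherian right module `M` is the
intersection of the annihilators of finitely many elements of `M`. -/
def ConditionH : Prop :=
  ∀ (M : Type u) [AddCommGroup M] [Module Rᵐᵒᵖ M], IsNoetherian Rᵐᵒᵖ M →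
    ∃ s : Finset M, Module.annihilator Rᵐᵒᵖ M = ⨅ m ∈ s, Ideal.torsionOf Rᵐᵒᵖ M m

variable {R} in
/-- A prime (two-sided) ideal of a not necessarily commutative ring: a proper ideal `P` such
that `I J ⊆ P` implies `I ⊆ P` or `J ⊆ P`, for two-sided ideals `I`, `J`. -/
def IsPrimeIdeal (P : TwoSidedIdeal R) : Prop :=
  P ≠ ⊤ ∧ ∀ I J : TwoSidedIdeal R, (∀ a ∈ I, ∀ b ∈ J, a * b ∈ P) → I ≤ P ∨ J ≤ P

/-- The set of prime ideals of `R`. -/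
def PrimeIdeals : Type u := {P : TwoSidedIdeal R // IsPrimeIdeal P}

/-- A prime right module: a non-zero module all of whose non-zero submodules have the same
annihilator. -/
def IsPrimeModule (M : Type u) [AddCommGroup M] [Module Rᵐᵒᵖ M] : Prop :=
  Nontrivial M ∧ ∀ N : Submodule Rᵐᵒᵖ M, N ≠ ⊥ →
    Module.annihilator Rᵐᵒᵖ N = Module.annihilator Rᵐᵒᵖ M

variable {R} in
/-- `P` is associated to the right module `E`: it is the annihilator of a prime submodule
of `E`. -/
def IsAssociated (P : TwoSidedIdeal R) (E : Type u) [AddCommGroup E] [Module Rᵐᵒᵖ E] : Prop :=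
  ∃ N : Submodule Rᵐᵒᵖ E, IsPrimeModule R N ∧ ∀ r : R, r ∈ P ↔ op r ∈ Module.annihilator Rᵐᵒᵖ N

/-- The category of indecomposable injective right `R`-modules. -/
abbrev IndecInj : Type (u + 1) :=
  ObjectProperty.FullSubcategory fun E : ModuleCat.{u} Rᵐᵒᵖ => Injective E ∧ Indecomposable E

/-- The isomorphism classes of indecomposable injective right `R`-modules. -/
abbrev IndecInjClasses : Type (u + 1) := Quotient (isIsomorphicSetoid (IndecInj R))

/-- The correspondence between prime ideals and indecomposable injectives, in which `P`
corresponds to `E` when `P` is associated to `E`, is a bijection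
(onto the isomorphism classes). -/
def PrimesBijectIndecInj : Prop :=
  ∃ Φ : PrimeIdeals R ≃ IndecInjClasses R, ∀ (P : PrimeIdeals R) (E : IndecInj R),
    Φ P = Quotient.mk (isIsomorphicSetoid (IndecInj R)) E ↔ IsAssociated P.1 E.obj

end Ring

end NCSpace

/-!
Right `R`-modules are left modules over `S = Rᵐᵒᵖ`, which is left noetherian because `S` is a
quotient of a finite sum of noetherian modules (`isNoetherianRing_of_isSeparating`).

**Closed subspaces and finiteness of annihilators.** Having enough closed subspaces is invariant
under equivalence, so it may be tested on `S`-modules. The smallest weakly closed subspace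
containing `M` consists of the modules subgenerated by `M`, that is, of those in which the annihilator
of each element contains the annihilator of a finite subset of `M` (`subgeneratedBy`). The smallest
closed subspace contains `S ⧸ Ann M`, which embeds in a power of `M`. The two agree exactly when
`S ⧸ Ann M` is subgenerated by `M`, and applied to the element `1` this says that `Ann M` is the
annihilator of a finite subset of `M` (`exists_isWeakSupport_and_isSupport_iff`).

**Primes and hulls.** An indecomposable injective module is uniform and has exactly one associated
prime, and each prime `Q` occurs, in the hull of a uniform submodule of `S ⧸ Q`. So the
correspondence is a bijection if and only if indecomposable injectives with the same associated
prime are isomorphic (`UniqueHullOverPrime`, `primesBijectIndecInj_iff`).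

If annihilators are finite intersections, then `S ⧸ Q` embeds in a finite power of any injective `E`
with associated prime `Q`. A uniform submodule of `S ⧸ Q` therefore embeds in `E` itself, and `E` is
its hull (`uniqueHullOverPrime_of_exists_annihilator_eq`).

Conversely, let hulls be unique. If `U` is uniform and prime with annihilator `Q`, then a proper
quotient of `U` is killed by an element outside of `Q`: otherwise a further quotient would share a
non-zero cyclic submodule with `S ⧸ Q`, whose elements would be singular, and a prime noetherian
ring has no non-zero singular elements (`UniqueHullOverPrime.exists_notMem_forall_smul_mem`). For a
noetherian module `M`, each such `U` in `S ⧸ Ann M` is mapped injectively to `M` by evaluation at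
some element of `M`; otherwise all its images, hence `U`, would be killed by an element outside of
`Q`. Adding such elements one at a time leads to a finite subset of `M` with annihilator `Ann M`,
because `S ⧸ Ann M` is noetherian (`UniqueHullOverPrime.exists_finset_ker_eq_bot`).
-/

namespace NCSpace

universe v' w'

/-! ### Prime and uniform submodules -/

section LeftModules

variable {S : Type u} [Ring S] {M : Type v} [AddCommGroup M] [Module S M]

/-- A two-sided prime ideal, encoded as a left ideal together with the elementwise form of
primeness: `a S b ⊆ Q` implies `a ∈ Q` or `b ∈ Q`. -/
structure IsTwoSidedPrime (Q : Ideal S) : Prop where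
  mul_mem_right : ∀ {a : S} (s : S), a ∈ Q → a * s ∈ Q
  one_notMem : (1 : S) ∉ Q
  mem_or_mem : ∀ {a b : S}, (∀ s, a * s * b ∈ Q) → a ∈ Q ∨ b ∈ Q

/-- `N` is a prime submodule with annihilator `Q`: it is non-zero, and each of its non-zero cyclic
submodules `S x` has annihilator `Q`. -/
def IsPrimeSubmodule (Q : Ideal S) (N : Submodule S M) : Prop :=
  N ≠ ⊥ ∧ ∀ x ∈ N, x ≠ 0 → ∀ s : S, (∀ t : S, s • t • x = 0) ↔ s ∈ Q

/-- `U` is a uniform submodule: it is non-zero, and any two of its non-zero submodules meet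
non-trivially. -/
def IsUniformSubmodule (U : Submodule S M) : Prop :=
  U ≠ ⊥ ∧ ∀ A ≤ U, ∀ B ≤ U, A ≠ ⊥ → B ≠ ⊥ → A ⊓ B ≠ ⊥

theorem IsPrimeSubmodule.mono {Q : Ideal S} {N N' : Submodule S M} (h : IsPrimeSubmodule Q N)
    (hle : N' ≤ N) (hne : N' ≠ ⊥) : IsPrimeSubmodule Q N' :=
  ⟨hne, fun x hx => h.2 x (hle hx)⟩

theorem IsUniformSubmodule.mono {U U' : Submodule S M} (h : IsUniformSubmodule U)
    (hle : U' ≤ U) (hne : U' ≠ ⊥) : IsUniformSubmodule U' :=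
  ⟨hne, fun A hA B hB => h.2 A (hA.trans hle) B (hB.trans hle)⟩

theorem IsPrimeSubmodule.smul_eq_zero {Q : Ideal S} {N : Submodule S M} (h : IsPrimeSubmodule Q N)
    {s : S} (hs : s ∈ Q) {x : M} (hx : x ∈ N) : s • x = 0 := by
  by_cases h0 : x = 0
  · simp [h0]
  · simpa using ((h.2 x hx h0 s).2 hs) 1

/-- A scalar that kills a non-zero submodule of a prime submodule lies in its annihilator. -/
theorem IsPrimeSubmodule.mem_of_forall_smul_eq_zero {Q : Ideal S} {N K : Submodule S M}
    (h : IsPrimeSubmodule Q N) (hK : K ≤ N) (hne : K ≠ ⊥) {s : S} (hs : ∀ x ∈ K, s • x = 0) :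
    s ∈ Q := by
  obtain ⟨x, hx, h0⟩ := K.ne_bot_iff.1 hne
  exact (h.2 x (hK hx) h0 s).1 fun t => hs _ (K.smul_mem t hx)

theorem IsPrimeSubmodule.isTwoSidedPrime {Q : Ideal S} {N : Submodule S M}
    (h : IsPrimeSubmodule Q N) : IsTwoSidedPrime Q where
  mul_mem_right {a} s ha := h.mem_of_forall_smul_eq_zero le_rfl h.1 fun x hx => by
    rw [mul_smul]
    exact h.smul_eq_zero ha (N.smul_mem s hx)
  one_notMem h1 := by
    obtain ⟨x, hx, h0⟩ := N.ne_bot_iff.1 h.1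
    exact h0 (by simpa using h.smul_eq_zero h1 hx)
  mem_or_mem {a b} hab := by
    by_contra! hc
    obtain ⟨x, hx, h0⟩ := N.ne_bot_iff.1 h.1
    obtain ⟨t, ht⟩ : ∃ t : S, b • t • x ≠ 0 := by
      by_contra! hb
      exact hc.2 ((h.2 x hx h0 b).1 hb)
    refine hc.1 ((h.2 _ (N.smul_mem b (N.smul_mem t hx)) ht a).1 fun s => ?_)
    have := h.smul_eq_zero (hab s) (N.smul_mem t hx)
    simpa only [mul_smul] using this

/-- Two submodules that are prime with annihilators `Q`, `Q'` and meet non-trivially have the same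
annihilator. -/
theorem IsPrimeSubmodule.eq_of_inf_ne_bot {Q Q' : Ideal S} {N N' : Submodule S M}
    (h : IsPrimeSubmodule Q N) (h' : IsPrimeSubmodule Q' N') (hne : N ⊓ N' ≠ ⊥) : Q = Q' := by
  obtain ⟨x, hx, h0⟩ := (N ⊓ N').ne_bot_iff.1 hne
  ext s
  rw [← h.2 x hx.1 h0, h'.2 x hx.2 h0]

theorem IsPrimeSubmodule.map {M' : Type w} [AddCommGroup M'] [Module S M'] {Q : Ideal S}
    {N : Submodule S M} (h : IsPrimeSubmodule Q N) (f : M →ₗ[S] M')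
    (hf : Function.Injective f) : IsPrimeSubmodule Q (N.map f) := by
  refine ⟨fun hb => h.1 (Submodule.map_injective_of_injective hf (by simpa using hb)), ?_⟩
  rintro _ ⟨x, hx, rfl⟩ h0 s
  rw [← h.2 x hx (fun h => h0 (by simp [h])) s]
  simp only [← map_smul, map_eq_zero_iff f hf]

theorem mem_annihilator_span_singleton {x : M} {s : S} :
    s ∈ Module.annihilator S (Submodule.span S {x}) ↔ ∀ t : S, s • t • x = 0 := by
  rw [← Submodule.annihilator, Submodule.mem_annihilator]
  refine ⟨fun h t => h _ (Submodule.smul_mem _ t (Submodule.mem_span_singleton_self x)), ?_⟩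
  intro h y hy
  obtain ⟨t, rfl⟩ := Submodule.mem_span_singleton.1 hy
  exact h t

/-- Over a left noetherian ring every non-zero submodule contains a prime one: take a cyclic
submodule whose annihilator is maximal. -/
theorem exists_isPrimeSubmodule_le [IsNoetherianRing S] {N : Submodule S M} (hN : N ≠ ⊥) :
    ∃ Q : Ideal S, ∃ N' ≤ N, IsPrimeSubmodule Q N' := by
  let A : M → Ideal S := fun x => (Submodule.span S {x}).annihilator
  have hA : ∀ x s, s ∈ A x ↔ ∀ t : S, s • t • x = 0 := fun x s =>
    mem_annihilator_span_singleton
  obtain ⟨x₀, hx₀, h₀⟩ := N.ne_bot_iff.1 hN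
  obtain ⟨_, ⟨x, hx, hx0, rfl⟩, hmax⟩ := set_has_maximal_iff_noetherian.2 ‹IsNoetherianRing S›
    {I : Ideal S | ∃ x ∈ N, x ≠ 0 ∧ A x = I} ⟨_, x₀, hx₀, h₀, rfl⟩
  refine ⟨A x, Submodule.span S {x}, by simpa using hx, by simpa using hx0, ?_⟩
  intro y hy hy0 s
  rw [← hA]
  have hle : A x ≤ A y :=
    Submodule.annihilator_mono (by simpa using hy)
  have hyN : y ∈ N := (Submodule.span_singleton_le_iff_mem x N).2 hx hy
  rw [hle.eq_of_not_lt (hmax _ ⟨y, hyN, hy0, rfl⟩)]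

theorem IsTwoSidedPrime.isPrimeSubmodule_top {Q : Ideal S} (h : IsTwoSidedPrime Q) :
    IsPrimeSubmodule Q (⊤ : Submodule S (S ⧸ Q)) := by
  refine ⟨?_, ?_⟩
  · rw [Submodule.ne_bot_iff]
    refine ⟨Submodule.Quotient.mk 1, trivial, ?_⟩
    rw [Ne, Submodule.Quotient.mk_eq_zero]
    exact h.one_notMem
  · intro x _ hx s
    obtain ⟨a, rfl⟩ := Submodule.Quotient.mk_surjective Q x
    rw [Ne, Submodule.Quotient.mk_eq_zero] at hx
    simp only [← Submodule.Quotient.mk_smul, Submodule.Quotient.mk_eq_zero, smul_eq_mul,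
      ← mul_assoc]
    refine ⟨fun hs => (h.mem_or_mem hs).resolve_right hx, fun hs t => ?_⟩
    exact h.mul_mem_right _ (h.mul_mem_right _ hs)

/-- A non-zero submodule of a noetherian module contains a uniform one: a submodule that meets a
maximal non-essential submodule trivially is uniform. -/
theorem exists_isUniformSubmodule_le [IsNoetherian S M] {N : Submodule S M} (hN : N ≠ ⊥) :
    ∃ U ≤ N, IsUniformSubmodule U := by
  obtain ⟨X, ⟨U, hUN, hU, hXU⟩, hmax⟩ := set_has_maximal_iff_noetherian.2 ‹IsNoetherian S M›
    {X : Submodule S M | ∃ U ≤ N, U ≠ ⊥ ∧ Disjoint X U} ⟨⊥, N, le_rfl, hN, disjoint_bot_left⟩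
  refine ⟨U, hUN, hU, fun A hA B hB hA0 hB0 hAB => ?_⟩
  refine hmax (X ⊔ A) ⟨B, hB.trans hUN, hB0, ?_⟩ (left_lt_sup.2 fun hAX => ?_)
  · rw [disjoint_comm]
    refine (disjoint_iff.2 hAB).symm.disjoint_sup_right_of_disjoint_sup_left ?_ |>.mono_right
      (le_of_eq (sup_comm _ _))
    exact (hXU.mono_right (sup_le hB hA)).symm
  · exact hA0 (disjoint_self.1 (hXU.mono hAX hA))

theorem IsUniformSubmodule.map {M' : Type w} [AddCommGroup M'] [Module S M'] 
    {U : Submodule S M} (h : IsUniformSubmodule U) (f : M →ₗ[S] M')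
    (hf : Function.Injective f) : IsUniformSubmodule (U.map f) := by
  refine ⟨fun hb => h.1 (Submodule.map_injective_of_injective hf (by simpa using hb)), ?_⟩
  intro A hA B hB hA0 hB0 hAB
  have hr : ∀ {A}, A ≤ U.map f → (A.comap f).map f = A := fun {A} hA =>
    Submodule.map_comap_eq_of_le (hA.trans LinearMap.map_le_range)
  have hne : ∀ {A}, A ≤ U.map f → A ≠ ⊥ → A.comap f ≠ ⊥ := fun {A} hA h0 hb =>
    h0 (by rw [← hr hA, hb, Submodule.map_bot])
  have hle : ∀ {A}, A ≤ U.map f → A.comap f ≤ U := fun {A} hA => by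
    rw [← Submodule.comap_map_eq_of_injective hf U]
    exact Submodule.comap_mono hA
  refine h.2 _ (hle hA) _ (hle hB) (hne hA hA0) (hne hB hB0) ?_
  rw [← Submodule.comap_inf, hAB, Submodule.comap_bot, LinearMap.ker_eq_bot.2 hf]

/-! ### Singular elements modulo a prime ideal -/

/-- A prime left noetherian ring has no non-zero singular elements, stated modulo the prime `Q`:
if the annihilator of `a` modulo `Q` is essential in `S ⧸ Q`, then `a ∈ Q`. -/
theorem IsTwoSidedPrime.mem_of_essential [IsNoetherianRing S] {Q : Ideal S}
    (h : IsTwoSidedPrime Q) {a : S} (ha : ∀ t ∉ Q, ∃ s, s * t ∉ Q ∧ s * t * a ∈ Q) : a ∈ Q := by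
  -- The singular elements form a two-sided ideal `Z`; one with maximal annihilator has `z Z ⊆ Q`.
  let Z : Set S := {a | ∀ t ∉ Q, ∃ s, s * t ∉ Q ∧ s * t * a ∈ Q}
  have hZr : ∀ {a} (r : S), a ∈ Z → a * r ∈ Z := fun r ha t ht => by
    obtain ⟨s, hs, hsa⟩ := ha t ht
    exact ⟨s, hs, by simpa only [mul_assoc] using h.mul_mem_right r hsa⟩
  have hZl : ∀ {a} (r : S), a ∈ Z → r * a ∈ Z := fun {a} r ha t ht => by
    by_cases htr : t * r ∈ Q
    · exact ⟨1, by simpa using ht, by simpa [mul_assoc] using h.mul_mem_right a htr⟩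
    · obtain ⟨s, hs, hsa⟩ := ha _ htr
      refine ⟨s, fun hst => hs ?_, by simpa only [mul_assoc] using hsa⟩
      simpa only [mul_assoc] using h.mul_mem_right r hst
  by_contra haQ
  let A : S → Ideal S := fun z => Submodule.comap (LinearMap.toSpanSingleton S S z) Q
  have hA : ∀ z s, s ∈ A z ↔ s * z ∈ Q := fun z s => Iff.rfl
  obtain ⟨_, ⟨z, hz, hzQ, rfl⟩, hmax⟩ := set_has_maximal_iff_noetherian.2 ‹IsNoetherianRing S›
    {I : Ideal S | ∃ z ∈ Z, z ∉ Q ∧ A z = I} ⟨_, a, ha, haQ, rfl⟩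
  have key : ∀ x ∈ Z, z * x ∈ Q := fun x hx => by
    by_contra hzx
    obtain ⟨s, hs, hsx⟩ := hx z hzQ
    refine hmax _ ⟨z * x, hZr x hz, hzx, rfl⟩ (SetLike.lt_iff_le_and_exists.2 ⟨fun t ht => ?_, s,
      by rwa [hA, ← mul_assoc], hs⟩)
    rw [hA] at ht ⊢
    simpa only [mul_assoc] using h.mul_mem_right x ht
  rcases h.mem_or_mem (a := z) (b := z) fun s => by
    simpa only [mul_assoc] using key _ (hZl s hz) with h1 | h1 <;> exact hzQ h1

end LeftModules

/-! ### Essential extensions and injective hulls -/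

section Hulls

variable {S : Type u} [Ring S] {M : Type v} [AddCommGroup M] [Module S M]

/-- `E` is an essential extension of `U` inside `M`: the non-zero submodules of `E` meet `U`
non-trivially. -/
def IsEssentialExtension (U E : Submodule S M) : Prop :=
  U ≤ E ∧ ∀ A ≤ E, Disjoint A U → A = ⊥

theorem IsEssentialExtension.trans {U E F : Submodule S M} (h : IsEssentialExtension U E)
    (h' : IsEssentialExtension E F) : IsEssentialExtension U F := by
  refine ⟨h.1.trans h'.1, fun A hA hd => h'.2 A hA (disjoint_iff.2 ?_)⟩
  exact h.2 _ inf_le_right (hd.mono_left inf_le_left)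

theorem exists_maximal_isEssentialExtension (U : Submodule S M) :
    ∃ E, Maximal (IsEssentialExtension U) E := by
  refine (zorn_le_nonempty₀ {E | IsEssentialExtension U E} (fun c hc hch y hy => ?_) U
    ⟨le_rfl, fun A hA hd => disjoint_self.1 (hd.mono_right hA)⟩).imp fun _ h => h.2
  refine ⟨sSup c, ⟨(hc hy).1.trans (le_sSup hy), fun A hA hd => ?_⟩, fun z hz => le_sSup hz⟩
  by_contra hA0
  obtain ⟨x, hx, hx0⟩ := A.ne_bot_iff.1 hA0
  obtain ⟨E, hE, hxE⟩ := (Submodule.mem_sSup_of_directed ⟨y, hy⟩ hch.directedOn).1 (hA hx)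
  refine hx0 (Submodule.span_singleton_eq_bot.1 ((hc hE).2 (Submodule.span S {x}) ?_ ?_))
  · simpa using hxE
  · exact hd.mono_left (by simpa using hx)

theorem exists_maximal_disjoint (E : Submodule S M) :
    ∃ X, Maximal (fun X => Disjoint E X) X := by
  refine (zorn_le_nonempty₀ {X | Disjoint E X} (fun c hc hch y hy => ?_) ⊥
    disjoint_bot_right).imp fun _ h => h.2
  refine ⟨sSup c, ?_, fun z hz => le_sSup hz⟩
  rw [Set.mem_ofPred_eq, Submodule.disjoint_def]
  intro x hx hxc
  obtain ⟨X, hX, hxX⟩ := (Submodule.mem_sSup_of_directed ⟨y, hy⟩ hch.directedOn).1 hxc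
  exact Submodule.disjoint_def.1 (hc hX) x hx hxX

theorem injective_of_isCompl {I : Type v} [AddCommGroup I] [Module S I] [Module.Injective S I]
    {E X : Submodule S I} (h : IsCompl E X) : Module.Injective S E where
  out A B _ _ _ _ f hf g := by
    obtain ⟨k, hk⟩ := Module.Injective.out f hf (E.subtype ∘ₗ g)
    refine ⟨E.projectionOnto X h ∘ₗ k, fun a => ?_⟩
    simp [hk]

/-- A maximal essential extension inside an injective module is a direct summand. For a maximal
`X` disjoint from `E`, extending `E → I` along `E → I ⧸ X` embeds `I ⧸ X` in `I` as an essential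
extension of `E`, which is `E` itself by maximality. -/
theorem exists_isCompl_of_maximal {I : Type v} [AddCommGroup I] [Module S I] [Module.Injective S I]
    {U E : Submodule S I} (h : Maximal (IsEssentialExtension U) E) : ∃ X, IsCompl E X := by
  obtain ⟨X, hEX, hX⟩ := exists_maximal_disjoint E
  have hi : Function.Injective (X.mkQ ∘ₗ E.subtype) := by
    rw [← LinearMap.ker_eq_bot, LinearMap.ker_eq_bot']
    rintro ⟨x, hx⟩ h0
    simpa using Submodule.disjoint_def.1 hEX x hx (by simpa using h0)
  obtain ⟨g, hg⟩ := Module.Injective.out _ hi E.subtype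
  replace hg : ∀ x ∈ E, g (X.mkQ x) = x := fun x hx => hg ⟨x, hx⟩
  have hess : ∀ B : Submodule S (I ⧸ X), Disjoint B (E.map X.mkQ) → B = ⊥ := fun B hB => by
    have hXB : X ≤ B.comap X.mkQ := by
      simpa using Submodule.comap_mono (f := X.mkQ) (bot_le : ⊥ ≤ B)
    have : B.comap X.mkQ ≤ X := hX (Submodule.disjoint_def.2 fun x hx hxB => by
      have := Submodule.disjoint_def.1 hB _ hxB (Submodule.mem_map_of_mem hx)
      exact Submodule.disjoint_def.1 hEX x hx (by simpa using this)) hXB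
    rw [← Submodule.map_comap_eq_of_surjective X.mkQ_surjective B, le_antisymm this hXB]
    simp
  have hgi : Function.Injective g := by
    rw [← LinearMap.ker_eq_bot]
    refine hess _ (Submodule.disjoint_def.2 ?_)
    rintro _ h0 ⟨x, hx, rfl⟩
    rw [LinearMap.mem_ker, hg x hx] at h0
    simp [h0]
  have hE : IsEssentialExtension E (LinearMap.range g) := by
    refine ⟨fun x hx => ⟨_, hg x hx⟩, fun A hA hd => ?_⟩
    have : A.comap g = ⊥ := hess _ (Submodule.disjoint_def.2 (by
      rintro _ hxA ⟨x, hx, rfl⟩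
      rw [Submodule.mem_comap, hg x hx] at hxA
      simp [Submodule.disjoint_def.1 hd x hxA hx]))
    rw [← Submodule.map_comap_eq_of_le hA, this, Submodule.map_bot]
  have hr : LinearMap.range g ≤ E := h.2 (h.1.trans hE) hE.1
  refine ⟨X, hEX, codisjoint_iff.2 (eq_top_iff.2 fun x _ => ?_)⟩
  have hy : g (X.mkQ x) ∈ E := hr ⟨_, rfl⟩
  rw [← add_sub_cancel (g (X.mkQ x)) x]
  refine Submodule.add_mem_sup hy ?_
  rw [← Submodule.Quotient.mk_eq_zero, ← Submodule.mkQ_apply, map_sub, sub_eq_zero]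
  exact hgi (hg _ hy).symm

/-- A linear map on a uniform module is injective if it is so on a non-zero submodule, as every
non-zero submodule is essential. -/
theorem injective_of_isUniformSubmodule_top {N : Type w} [AddCommGroup N] [Module S N]
    (hM : IsUniformSubmodule (⊤ : Submodule S M)) (g : M →ₗ[S] N) {A : Submodule S M}
    (hA : A ≠ ⊥) (hg : ∀ x ∈ A, g x = 0 → x = 0) : Function.Injective g := by
  rw [← LinearMap.ker_eq_bot]
  by_contra hk
  refine hM.2 _ le_top _ le_top hk hA ((Submodule.eq_bot_iff _).2 fun x hx => hg x hx.2 hx.1)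

/-- Injective uniform modules that share a non-zero submodule up to isomorphism are isomorphic. -/
theorem nonempty_linearEquiv_of_isUniformSubmodule_top {U E E' : Type v}
    [AddCommGroup U] [Module S U] [AddCommGroup E] [Module S E] [AddCommGroup E'] [Module S E']
    [Module.Injective S E] [Module.Injective S E'] [Nontrivial U]
    (hE : IsUniformSubmodule (⊤ : Submodule S E)) (hE' : IsUniformSubmodule (⊤ : Submodule S E'))
    (i : U →ₗ[S] E) (j : U →ₗ[S] E') (hi : Function.Injective i) (hj : Function.Injective j) :
    Nonempty (E ≃ₗ[S] E') := by
  have hne : ∀ {N : Type v} [AddCommGroup N] [Module S N] (f : U →ₗ[S] N),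
      Function.Injective f → LinearMap.range f ≠ ⊥ := fun f hf h0 => by
    obtain ⟨x, hx⟩ := exists_ne (0 : U)
    exact hx (hf (by simpa [h0] using LinearMap.mem_range_self f x))
  obtain ⟨g, hg⟩ := Module.Injective.out i hi j
  obtain ⟨r, hr⟩ := Module.Injective.out j hj i
  have hgi : Function.Injective g := injective_of_isUniformSubmodule_top hE g (hne i hi) (by
    rintro _ ⟨x, rfl⟩ h0
    rw [hg] at h0
    rw [hj (h0.trans (map_zero j).symm), map_zero])
  obtain ⟨r, hr⟩ := Module.Injective.out g hgi LinearMap.id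
  have hri : Function.Injective r := injective_of_isUniformSubmodule_top hE' r (hne j hj) (by
    rintro _ ⟨x, rfl⟩ h0
    rw [← hg, hr, LinearMap.id_apply] at h0
    rw [hi (h0.trans (map_zero i).symm), map_zero])
  exact ⟨.ofBijective g ⟨hgi, fun y => ⟨r y, hri (by rw [hr, LinearMap.id_apply])⟩⟩⟩

end Hulls

section Indecomposable

variable {S : Type u} [Ring S]

theorem eq_bot_or_eq_bot_of_indecomposable {E : ModuleCat.{u} S} (h : Indecomposable E)
    {A B : Submodule S E} (hAB : IsCompl A B) : A = ⊥ ∨ B = ⊥ := by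
  have hz : ∀ A : Submodule S E, Limits.IsZero (ModuleCat.of S A) → A = ⊥ := fun A hA => by
    have := ModuleCat.subsingleton_of_isZero hA
    exact Submodule.eq_bot_of_subsingleton
  exact (h.2 (ModuleCat.of S A) (ModuleCat.of S B)
    ((Submodule.prodEquivOfIsCompl A B hAB).symm.toModuleIso ≪≫
      (ModuleCat.biprodIsoProd (.of S A) (.of S B)).symm)).imp (hz A) (hz B)

/-- An indecomposable injective module is uniform: a maximal essential extension of a non-zero
submodule is a non-zero direct summand, hence everything. -/
theorem isUniformSubmodule_top_of_indecomposable {E : ModuleCat.{u} S} [Module.Injective S E]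
    (h : Indecomposable E) : IsUniformSubmodule (⊤ : Submodule S E) := by
  have hne : (⊤ : Submodule S E) ≠ ⊥ := fun h0 => h.1 (by
    have : Subsingleton E := (Submodule.subsingleton_iff S).1 (subsingleton_of_bot_eq_top h0.symm)
    exact ModuleCat.isZero_of_subsingleton E)
  refine ⟨hne, fun A _ B _ hA hB hAB => ?_⟩
  obtain ⟨F, hF⟩ := exists_maximal_isEssentialExtension A
  obtain ⟨X, hX⟩ := exists_isCompl_of_maximal hF
  rcases eq_bot_or_eq_bot_of_indecomposable h hX with h0 | h0
  · exact hA (le_bot_iff.1 (h0 ▸ hF.1.1))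
  · have hT : F = ⊤ := by simpa [h0] using hX.sup_eq_top
    exact hB (hF.1.2 B (hT ▸ le_top) (disjoint_iff.2 (by rw [inf_comm, hAB])))

theorem indecomposable_of_isUniformSubmodule_top {E : ModuleCat.{u} S}
    (h : IsUniformSubmodule (⊤ : Submodule S E)) : Indecomposable E := by
  refine ⟨fun hz => h.1 ?_, fun Y Z i => ?_⟩
  · have := ModuleCat.subsingleton_of_isZero hz
    exact Submodule.eq_bot_of_subsingleton
  · by_contra! hc
    have hne : ∀ {Y : ModuleCat.{u} S} (f : Y ⟶ E) (g : E ⟶ Y), f ≫ g = 𝟙 Y →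
        ¬ Limits.IsZero Y → LinearMap.range f.hom ≠ ⊥ := fun f g hfg hY hb => hY <| by
      rw [Limits.IsZero.iff_id_eq_zero, ← hfg,
        show f = 0 from ModuleCat.hom_ext (LinearMap.range_eq_bot.1 hb), Limits.zero_comp]
    refine h.2 _ le_top _ le_top
      (hne (Limits.biprod.inl ≫ i.inv) (i.hom ≫ Limits.biprod.fst) (by simp) hc.1)
      (hne (Limits.biprod.inr ≫ i.inv) (i.hom ≫ Limits.biprod.snd) (by simp) hc.2)
      ((Submodule.eq_bot_iff _).2 ?_)
    rintro _ ⟨⟨y, rfl⟩, z, hz⟩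
    have h1 : (Limits.biprod.inl ≫ i.inv) ≫ i.hom ≫ Limits.biprod.fst = 𝟙 Y := by simp
    have h2 : (Limits.biprod.inr ≫ i.inv) ≫ i.hom ≫ Limits.biprod.fst = (0 : Z ⟶ Y) := by simp
    have h1y := congr($(h1).hom y)
    have h2z := congr($(h2).hom z)
    rw [ModuleCat.hom_comp, LinearMap.comp_apply] at h1y h2z
    rw [hz, h1y] at h2z
    have : y = 0 := h2z
    rw [this, map_zero]

/-- Every uniform submodule embeds in an injective uniform module, its injective hull. -/
theorem exists_injective_isUniformSubmodule_top {M : Type u} [AddCommGroup M] [Module S M]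
    {U : Submodule S M} (hU : IsUniformSubmodule U) :
    ∃ (E : ModuleCat.{u} S) (i : U →ₗ[S] E), Function.Injective i ∧ Module.Injective S E ∧
      IsUniformSubmodule (⊤ : Submodule S E) := by
  let ι := Injective.ι (ModuleCat.of S M)
  have hι : Function.Injective ι.hom := (ModuleCat.mono_iff_injective ι).1 inferInstance
  have : Module.Injective S (Injective.under (ModuleCat.of S M) : ModuleCat.{u} S) :=
    Module.injective_module_of_injective_object S _ (inj := inferInstanceAs
      (Injective (Injective.under (ModuleCat.of S M))))
  have hV := hU.map ι.hom hι
  set V := U.map ι.hom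
  obtain ⟨F, hF⟩ := exists_maximal_isEssentialExtension V
  obtain ⟨X, hX⟩ := exists_isCompl_of_maximal hF
  have hVF : ∀ x : U, (ι.hom ∘ₗ U.subtype) x ∈ F := fun x =>
    hF.1.1 (Submodule.mem_map_of_mem x.2)
  refine ⟨.of S F, (ι.hom ∘ₗ U.subtype).codRestrict F hVF, fun x y hxy => ?_,
    injective_of_isCompl hX, ?_⟩
  · exact Subtype.ext (hι congr(($hxy).1))
  · have hFu : IsUniformSubmodule F := by
      refine ⟨fun h0 => hV.1 (le_bot_iff.1 (h0 ▸ hF.1.1)), fun A hA B hB hA0 hB0 hAB => ?_⟩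
      refine hV.2 (A ⊓ V) inf_le_right (B ⊓ V) inf_le_right
        (fun h0 => hA0 (hF.1.2 A hA (disjoint_iff.2 h0)))
        (fun h0 => hB0 (hF.1.2 B hB (disjoint_iff.2 h0))) (le_bot_iff.1 ?_)
      rw [← hAB]
      exact inf_le_inf inf_le_left inf_le_left
    refine ⟨fun h0 => hFu.1 ?_, fun A _ B _ hA0 hB0 hAB => ?_⟩
    · have := congrArg (Submodule.map F.subtype) h0
      simpa using this
    · have hinj := Submodule.map_injective_of_injective F.subtype_injective
      refine hFu.2 (A.map F.subtype) (Submodule.map_subtype_le _ _) (B.map F.subtype)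
        (Submodule.map_subtype_le _ _) (fun h0 => hA0 (hinj (by simpa using h0)))
        (fun h0 => hB0 (hinj (by simpa using h0))) ?_
      rw [← Submodule.map_inf _ F.subtype_injective, hAB, Submodule.map_bot]

end Indecomposable

/-! ### Finiteness of annihilators from uniqueness of the hull over a prime -/

section Hull

variable {S : Type u} [Ring S]

variable (S) in
/-- Indecomposable injective modules with a common associated prime are isomorphic. -/
def UniqueHullOverPrime : Prop :=
  ∀ E E' : ModuleCat.{u} S, Module.Injective S E → Module.Injective S E' →
    IsUniformSubmodule (⊤ : Submodule S E) → IsUniformSubmodule (⊤ : Submodule S E') →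
    ∀ (Q : Ideal S) (N : Submodule S E) (N' : Submodule S E'),
      IsPrimeSubmodule Q N → IsPrimeSubmodule Q N' → Nonempty (E ≃ₗ[S] E')

theorem IsPrimeSubmodule.top {M : Type v} [AddCommGroup M] [Module S M] {Q : Ideal S}
    {N : Submodule S M} (h : IsPrimeSubmodule Q N) :
    IsPrimeSubmodule Q (⊤ : Submodule S N) := by
  refine ⟨fun h0 => h.1 (by simpa using congrArg (Submodule.map N.subtype) h0), ?_⟩
  rintro ⟨x, hx⟩ - h0 s
  simpa [Subtype.ext_iff] using h.2 x hx (by simpa using h0) s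

/-- The hull of a uniform prime submodule is an injective uniform module with the same associated
prime. -/
theorem exists_injective_isPrimeSubmodule {M : Type u} [AddCommGroup M] [Module S M] {Q : Ideal S}
    {U : Submodule S M} (hU : IsUniformSubmodule U) (hQ : IsPrimeSubmodule Q U) :
    ∃ (E : ModuleCat.{u} S) (i : U →ₗ[S] E), Function.Injective i ∧ Module.Injective S E ∧
      IsUniformSubmodule (⊤ : Submodule S E) ∧ IsPrimeSubmodule Q (LinearMap.range i) := by
  obtain ⟨E, i, hi, hE, hu⟩ := exists_injective_isUniformSubmodule_top hU
  exact ⟨E, i, hi, hE, hu, LinearMap.range_eq_map i ▸ hQ.top.map i hi⟩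

/-- A prime submodule with annihilator `Q` shares a non-zero cyclic module with `S ⧸ Q`, up to
isomorphism: uniform submodules of the two have isomorphic hulls. The isomorphism `S y ≅ S a`
modulo `Q` is expressed by the equality of the annihilators of the generators. -/
theorem UniqueHullOverPrime.exists_smul_eq_zero_iff [IsNoetherianRing S]
    (h : UniqueHullOverPrime S) {M : Type u} [AddCommGroup M] [Module S M] [IsNoetherian S M]
    {Q : Ideal S} {N : Submodule S M} (hN : IsPrimeSubmodule Q N) :
    ∃ y ∈ N, y ≠ 0 ∧ ∃ a ∉ Q, ∀ s : S, s • y = 0 ↔ s * a ∈ Q := by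
  obtain ⟨U, hUN, hU⟩ := exists_isUniformSubmodule_le hN.1
  have hT := hN.isTwoSidedPrime.isPrimeSubmodule_top
  obtain ⟨V, hVT, hV⟩ := exists_isUniformSubmodule_le hT.1
  obtain ⟨E, i, hi, hE, hEu, hEp⟩ := exists_injective_isPrimeSubmodule hU (hN.mono hUN hU.1)
  obtain ⟨E', j, hj, hE', hEu', hEp'⟩ := exists_injective_isPrimeSubmodule hV (hT.mono hVT hV.1)
  obtain ⟨e⟩ := h E E' hE hE' hEu hEu' Q _ _ hEp hEp'
  obtain ⟨z, ⟨⟨_, ⟨x, rfl⟩, hx⟩, ⟨v, hv⟩⟩, hz⟩ := (Submodule.ne_bot_iff _).1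
    (hEu'.2 _ le_top _ le_top (hEp.map e.toLinearMap e.injective).1 hEp'.1)
  obtain ⟨a, ha⟩ := Submodule.Quotient.mk_surjective Q v.1
  have key : ∀ s : S, s • x = 0 ↔ s • v = 0 := fun s => by
    rw [← map_eq_zero_iff i hi, ← map_eq_zero_iff e e.injective, ← map_eq_zero_iff j hj]
    simp only [map_smul]
    rw [hv, ← hx]
    rfl
  have key' : ∀ s : S, s • x.1 = 0 ↔ s * a ∈ Q := fun s => by
    rw [← Submodule.coe_smul, Submodule.coe_eq_zero, key, ← Submodule.coe_eq_zero,
      Submodule.coe_smul, ← ha, ← Submodule.Quotient.mk_smul, Submodule.Quotient.mk_eq_zero,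
      smul_eq_mul]
  have hx0 : x.1 ≠ 0 := fun h0 => hz (by
    rw [Submodule.coe_eq_zero] at h0
    rw [← hx, h0, map_zero, map_zero])
  refine ⟨x.1, hUN x.2, hx0, a, fun haQ => hx0 ?_, key'⟩
  simpa using (key' 1).2 (by simpa using haQ)

/-- A proper quotient `U ⧸ K` of a uniform prime module with annihilator `Q` has an annihilator
that is strictly larger than `Q`.

Otherwise enlarge `K` to a maximal `L` such that `U ⧸ L` has annihilator `Q`. Then `U ⧸ L` is prime,
so it contains a copy of a non-zero left ideal of `S ⧸ Q`. But all elements of `U ⧸ L` are singular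
modulo `Q`, as `K` is essential in `U`. -/
theorem UniqueHullOverPrime.exists_notMem_forall_smul_mem [IsNoetherianRing S]
    (h : UniqueHullOverPrime S) {M : Type u} [AddCommGroup M] [Module S M] [IsNoetherian S M]
    {Q : Ideal S} {U K : Submodule S M} (hU : IsUniformSubmodule U) (hQ : IsPrimeSubmodule Q U)
    (hKU : K ≤ U) (hK : K ≠ ⊥) : ∃ b ∉ Q, ∀ x ∈ U, b • x ∈ K := by
  by_contra! hc
  obtain ⟨L, ⟨hKL, hLU, hL⟩, hmax⟩ := set_has_maximal_iff_noetherian.2 ‹IsNoetherian S M›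
    {L : Submodule S M | K ≤ L ∧ L ≤ U ∧ ∀ b, (∀ x ∈ U, b • x ∈ L) → b ∈ Q}
    ⟨K, le_rfl, hKU, fun b hb => by
      by_contra hbQ
      obtain ⟨x, hx, hx'⟩ := hc b hbQ
      exact hx' (hb x hx)⟩
  have hP := hQ.isTwoSidedPrime
  have hprime : IsPrimeSubmodule Q (U.map L.mkQ) := by
    refine ⟨fun h0 => hP.one_notMem (hL 1 fun x hx => ?_), ?_⟩
    · have : L.mkQ x ∈ U.map L.mkQ := Submodule.mem_map_of_mem hx
      rw [h0, Submodule.mem_bot, Submodule.mkQ_apply, Submodule.Quotient.mk_eq_zero] at this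
      simpa using this
    · rintro _ ⟨u, hu, rfl⟩ hu0 s
      rw [Ne, Submodule.mkQ_apply, Submodule.Quotient.mk_eq_zero] at hu0
      simp only [Submodule.mkQ_apply, ← Submodule.Quotient.mk_smul, Submodule.Quotient.mk_eq_zero]
      refine ⟨fun hs => ?_, fun hs t => by
        rw [hQ.smul_eq_zero hs (U.smul_mem t hu)]
        exact L.zero_mem⟩
      -- By maximality of `L`, some `b ∉ Q` maps `U` into `L + S u`; then `s S b` maps `U` to `L`.
      obtain ⟨b, hbL, hbQ⟩ : ∃ b, (∀ x ∈ U, b • x ∈ L ⊔ Submodule.span S {u}) ∧ b ∉ Q := by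
        by_contra! hb
        exact hmax (L ⊔ Submodule.span S {u}) ⟨hKL.trans le_sup_left,
          sup_le hLU (by simpa using hu), hb⟩ (left_lt_sup.2 (by simpa using hu0))
      refine (hP.mem_or_mem fun t => hL _ fun x hx => ?_).resolve_right hbQ
      obtain ⟨l, hl, _, hy, hly⟩ := Submodule.mem_sup.1 (hbL x hx)
      obtain ⟨c, rfl⟩ := Submodule.mem_span_singleton.1 hy
      rw [mul_smul, mul_smul, ← hly, smul_add, smul_add, smul_smul t c]
      exact L.add_mem (L.smul_mem _ (L.smul_mem _ hl)) (hs _)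
  obtain ⟨_, ⟨u, hu, rfl⟩, -, a, haQ, ha⟩ := h.exists_smul_eq_zero_iff hprime
  simp only [Submodule.mkQ_apply, ← Submodule.Quotient.mk_smul, Submodule.Quotient.mk_eq_zero] at ha
  refine haQ (hP.mem_of_essential fun t ht => ?_)
  by_cases h0 : t • u = 0
  · exact ⟨1, by simpa using ht, (ha _).1 (by simp [h0])⟩
  · obtain ⟨_, ⟨hx, hxK⟩, hx0⟩ := (Submodule.ne_bot_iff _).1 (hU.2 (Submodule.span S {t • u})
      (by simpa using U.smul_mem t hu) K hKU (by simpa using h0) hK)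
    obtain ⟨s, rfl⟩ := Submodule.mem_span_singleton.1 hx
    rw [smul_smul] at hxK hx0
    exact ⟨s, fun hst => hx0 (hQ.smul_eq_zero hst hu), (ha _).1 (hKL hxK)⟩

/-- If the kernels of linear maps from `X` to the noetherian module `M` have intersection zero,
one of the maps is injective on a given uniform prime submodule `U`.

Otherwise each image of `U` is killed by an element outside of the annihilator `Q` of `U`. As `M` is
noetherian, one such element kills all images, hence `U` itself. -/
theorem UniqueHullOverPrime.exists_disjoint_ker [IsNoetherianRing S]
    (h : UniqueHullOverPrime S) {X M : Type u} [AddCommGroup X] [Module S X] [IsNoetherian S X]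
    [AddCommGroup M] [Module S M] [IsNoetherian S M] {ι : Type v} (φ : ι → X →ₗ[S] M)
    (hφ : ∀ x, (∀ i, φ i x = 0) → x = 0) {Q : Ideal S} {U : Submodule S X}
    (hU : IsUniformSubmodule U) (hQ : IsPrimeSubmodule Q U) :
    ∃ i, Disjoint U (LinearMap.ker (φ i)) := by
  by_contra! hc
  have hP := hQ.isTwoSidedPrime
  obtain ⟨T, ⟨b, hbQ, hb⟩, hmax⟩ := set_has_maximal_iff_noetherian.2 ‹IsNoetherian S M›
    {T : Submodule S M | ∃ b ∉ Q, ∀ x ∈ T, b • x = 0} ⟨⊥, 1, hP.one_notMem, by simp⟩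
  have hT : ∀ i, U.map (φ i) ≤ T := fun i => by
    obtain ⟨c, hcQ, hcU⟩ := h.exists_notMem_forall_smul_mem hU hQ inf_le_left
      (fun h0 => hc i (disjoint_iff.2 h0))
    obtain ⟨s, hs⟩ : ∃ s, b * s * c ∉ Q := by
      by_contra! hs
      exact (hP.mem_or_mem hs).elim hbQ hcQ
    by_contra hi
    refine hmax (T ⊔ U.map (φ i)) ⟨_, hs, fun x hx => ?_⟩ (left_lt_sup.2 hi)
    obtain ⟨y, hy, _, ⟨u, hu, rfl⟩, rfl⟩ := Submodule.mem_sup.1 hx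
    have h1 : c • φ i u = 0 := by
      rw [← map_smul]
      exact (hcU u hu).2
    rw [mul_smul, mul_smul, smul_add, h1, add_zero]
    exact hb _ (T.smul_mem _ (T.smul_mem _ hy))
  refine hbQ (hQ.mem_of_forall_smul_eq_zero le_rfl hU.1 fun x hx => hφ _ fun i => ?_)
  rw [map_smul]
  exact hb _ (hT i (Submodule.mem_map_of_mem hx))

/-- A noetherian module that embeds in a power of the noetherian module `M` embeds in a finite
power of `M`. -/
theorem UniqueHullOverPrime.exists_finset_ker_eq_bot [IsNoetherianRing S]
    (h : UniqueHullOverPrime S) {X M : Type u} [AddCommGroup X] [Module S X] [IsNoetherian S X]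
    [AddCommGroup M] [Module S M] [IsNoetherian S M] {ι : Type v} (φ : ι → X →ₗ[S] M)
    (hφ : ∀ x, (∀ i, φ i x = 0) → x = 0) :
    ∃ F : Finset ι, ∀ x, (∀ i ∈ F, φ i x = 0) → x = 0 := by
  classical
  let J : Finset ι → Submodule S X := fun F => ⨅ i ∈ F, LinearMap.ker (φ i)
  have hJ : ∀ F x, x ∈ J F ↔ ∀ i ∈ F, φ i x = 0 := fun F x => by simp [J]
  -- A maximal submodule `D` on which a finite subfamily `F` is jointly injective. If the common
  -- kernel `J F` is non-zero, it contains a uniform prime submodule `N` on which a single map is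
  -- injective. Adding this map to `F` enlarges `D` to `D ⊔ N`.
  obtain ⟨D, ⟨F, hF⟩, hmax⟩ := set_has_maximal_iff_noetherian.2 ‹IsNoetherian S X›
    {D : Submodule S X | ∃ F, Disjoint D (J F)} ⟨⊥, ∅, disjoint_bot_left⟩
  refine ⟨F, fun x hx => ?_⟩
  by_contra hx0
  have hJF : J F ≠ ⊥ := (Submodule.ne_bot_iff _).2 ⟨x, (hJ F x).2 hx, hx0⟩
  obtain ⟨U, hUJ, hU⟩ := exists_isUniformSubmodule_le hJF
  obtain ⟨Q, N, hNU, hN⟩ := exists_isPrimeSubmodule_le hU.1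
  obtain ⟨i, hi⟩ := h.exists_disjoint_ker φ hφ (hU.mono hNU hN.1) hN
  have hNJ := hNU.trans hUJ
  refine hmax (D ⊔ N) ⟨insert i F, Submodule.disjoint_def.2 fun y hy hyJ => ?_⟩
    (left_lt_sup.2 fun hND => hN.1 (disjoint_self.1 (hF.mono hND hNJ)))
  obtain ⟨d, hd, n, hn, rfl⟩ := Submodule.mem_sup.1 hy
  rw [hJ, Finset.forall_mem_insert] at hyJ
  have hdJ : d ∈ J F := by
    rw [← add_sub_cancel_right d n]
    exact (J F).sub_mem ((hJ F _).2 hyJ.2) (hNJ hn)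
  have hd0 : d = 0 := Submodule.disjoint_def.1 hF d hd hdJ
  rw [hd0, zero_add] at hyJ ⊢
  exact Submodule.disjoint_def.1 hi n hn hyJ.1

theorem annihilator_le_torsionOf {M : Type v} [AddCommGroup M] [Module S M] (m : M) :
    Module.annihilator S M ≤ Ideal.torsionOf S M m := fun _ hs =>
  (Ideal.mem_torsionOf_iff _ _).2 (Module.mem_annihilator.1 hs m)

theorem UniqueHullOverPrime.exists_annihilator_eq [IsNoetherianRing S]
    (h : UniqueHullOverPrime S) (M : Type u) [AddCommGroup M] [Module S M] [IsNoetherian S M] :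
    ∃ F : Finset M, Module.annihilator S M = ⨅ m ∈ F, Ideal.torsionOf S M m := by
  let φ : M → (S ⧸ Module.annihilator S M) →ₗ[S] M := fun m =>
    Submodule.liftQ _ (LinearMap.toSpanSingleton S M m) (annihilator_le_torsionOf m)
  have hφ : ∀ m s, φ m (Submodule.Quotient.mk s) = s • m := fun m s => rfl
  obtain ⟨F, hF⟩ := h.exists_finset_ker_eq_bot φ fun x hx => by
    obtain ⟨s, rfl⟩ := Submodule.Quotient.mk_surjective _ x
    exact (Submodule.Quotient.mk_eq_zero _).2 (Module.mem_annihilator.2 hx)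
  refine ⟨F, le_antisymm (le_iInf₂ fun m _ => annihilator_le_torsionOf m) fun s hs => ?_⟩
  simp only [Submodule.mem_iInf, Ideal.mem_torsionOf_iff] at hs
  exact (Submodule.Quotient.mk_eq_zero _).1 (hF _ hs)

/-! ### Uniqueness of the hull over a prime from finiteness of annihilators -/

theorem IsUniformSubmodule.exists_disjoint {M : Type v} [AddCommGroup M] [Module S M]
    {U : Submodule S M} (hU : IsUniformSubmodule U) {ι : Type w} (F : Finset ι)
    (K : ι → Submodule S M) (hK : Disjoint U (⨅ i ∈ F, K i)) : ∃ i ∈ F, Disjoint U (K i) := by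
  classical
  induction F using Finset.induction_on with
  | empty => exact absurd (by simpa using hK) hU.1
  | insert i F _ ih =>
    by_cases hi : Disjoint U (K i)
    · exact ⟨i, Finset.mem_insert_self _ _, hi⟩
    · obtain ⟨j, hj, hUj⟩ := ih (by
        by_contra hc
        rw [Finset.iInf_insert] at hK
        refine hU.2 _ inf_le_left _ inf_le_left (fun h => hi (disjoint_iff.2 h))
          (fun h => hc (disjoint_iff.2 h)) ?_
        rw [← inf_inf_distrib_left]
        exact disjoint_iff.1 hK)
      exact ⟨j, Finset.mem_insert_of_mem hj, hUj⟩

/-- If `Q` is the annihilator of finitely many elements of `E`, then `S ⧸ Q` embeds in a finite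
power of `E`, so its uniform submodules embed in `E`. -/
theorem exists_injective_of_eq_iInf_torsionOf {E : Type v} [AddCommGroup E] [Module S E]
    {Q : Ideal S} {F : Finset E} (hF : Q = ⨅ m ∈ F, Ideal.torsionOf S E m)
    {V : Submodule S (S ⧸ Q)} (hV : IsUniformSubmodule V) :
    ∃ i : V →ₗ[S] E, Function.Injective i := by
  have hle : ∀ m : F, Q ≤ Ideal.torsionOf S E m.1 := fun m => hF.trans_le (iInf₂_le m.1 m.2)
  let φ : F → (S ⧸ Q) →ₗ[S] E := fun m =>
    Submodule.liftQ _ (LinearMap.toSpanSingleton S E m.1) (hle m)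
  obtain ⟨m, -, hm⟩ := hV.exists_disjoint Finset.univ (fun m => LinearMap.ker (φ m)) (by
    refine Submodule.disjoint_def.2 fun x _ hx => ?_
    obtain ⟨s, rfl⟩ := Submodule.Quotient.mk_surjective _ x
    rw [Submodule.Quotient.mk_eq_zero, hF]
    simp only [Submodule.mem_iInf, Ideal.mem_torsionOf_iff]
    simp only [Submodule.mem_iInf] at hx
    exact fun m hm => hx ⟨m, hm⟩ (Finset.mem_univ _))
  refine ⟨φ m ∘ₗ V.subtype, ?_⟩
  rw [← LinearMap.ker_eq_bot, LinearMap.ker_eq_bot']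
  exact fun x hx => Subtype.ext (Submodule.disjoint_def.1 hm x.1 x.2 hx)

theorem uniqueHullOverPrime_of_exists_annihilator_eq [IsNoetherianRing S]
    (h : ∀ (M : Type u) [AddCommGroup M] [Module S M], IsNoetherian S M →
      ∃ F : Finset M, Module.annihilator S M = ⨅ m ∈ F, Ideal.torsionOf S M m) :
    UniqueHullOverPrime S := by
  have key : ∀ (E : ModuleCat.{u} S) (Q : Ideal S) (N : Submodule S E), IsPrimeSubmodule Q N →
      ∃ F : Finset E, Q = ⨅ m ∈ F, Ideal.torsionOf S E m := fun E Q N hN => by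
    classical
    obtain ⟨x, hx, hx0⟩ := N.ne_bot_iff.1 hN.1
    obtain ⟨F, hF⟩ := h (Submodule.span S {x}) inferInstance
    refine ⟨F.image Subtype.val, ?_⟩
    ext s
    rw [← hN.2 x hx hx0 s, ← mem_annihilator_span_singleton, hF]
    simp [Submodule.mem_iInf, Ideal.mem_torsionOf_iff, Subtype.ext_iff]
  intro E E' hE hE' hEu hEu' Q N N' hN hN'
  obtain ⟨V, -, hV⟩ := exists_isUniformSubmodule_le hN.isTwoSidedPrime.isPrimeSubmodule_top.1
  obtain ⟨F, hF⟩ := key E Q N hN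
  obtain ⟨F', hF'⟩ := key E' Q N' hN'
  obtain ⟨i, hi⟩ := exists_injective_of_eq_iInf_torsionOf hF hV
  obtain ⟨j, hj⟩ := exists_injective_of_eq_iInf_torsionOf hF' hV
  have : Nontrivial V := Submodule.nontrivial_iff_ne_bot.2 hV.1
  exact nonempty_linearEquiv_of_isUniformSubmodule_top hEu hEu' i j hi hj

end Hull

/-! ### Subspaces and equivalences of categories -/

section Transport

variable {C : Type w} [Category.{v} C] {D : Type w'} [Category.{v'} D]

theorem isNoetherianObject_functor_obj (e : C ≌ D) {X : C} (hX : IsNoetherianObject X) :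
    IsNoetherianObject (e.functor.obj X) := by
  have i : Subobject X ≃o Subobject (e.functor.obj X) :=
    ((MonoOver.congr X e).trans
      (ThinSkeleton.equivalence (MonoOver (e.functor.obj X))).symm).thinSkeletonOrderIso
  exact (isNoetherianObject.is_iff _).2 i.symm.strictMono.wellFoundedGT

theorem isLeftAdjoint_ι_inverseImage {W : ObjectProperty C} [W.IsClosedUnderIsomorphisms]
    (hW : W.ι.IsLeftAdjoint) (e : D ≌ C) : (W.inverseImage e.functor).ι.IsLeftAdjoint := by
  let ε := e.congrFullSubcategory (P := W.inverseImage e.functor) (Q := W) rfl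
  rw [← Functor.isLeftAdjoint_comp_iff_left _ e.functor]
  exact inferInstanceAs (ε.functor ⋙ W.ι).IsLeftAdjoint

theorem isRightAdjoint_ι_inverseImage {W : ObjectProperty C} [W.IsClosedUnderIsomorphisms]
    (hW : W.ι.IsRightAdjoint) (e : D ≌ C) : (W.inverseImage e.functor).ι.IsRightAdjoint := by
  let ε := e.congrFullSubcategory (P := W.inverseImage e.functor) (Q := W) rfl
  rw [← Functor.isRightAdjoint_comp_iff_left _ e.functor]
  exact inferInstanceAs (ε.functor ⋙ W.ι).IsRightAdjoint

theorem IsWeaklyClosed.inverseImage {W : ObjectProperty C} (hW : IsWeaklyClosed W) (e : D ≌ C) :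
    IsWeaklyClosed (W.inverseImage e.functor) where
  subobjects := have := hW.subobjects; inferInstance
  quotients := have := hW.quotients; inferInstance
  hasRightAdjoint := have := hW.subobjects; isLeftAdjoint_ι_inverseImage hW.hasRightAdjoint e

theorem IsClosed.inverseImage {Z : ObjectProperty C} (hZ : IsClosed Z) (e : D ≌ C) :
    IsClosed (Z.inverseImage e.functor) where
  toIsWeaklyClosed := hZ.toIsWeaklyClosed.inverseImage e
  hasLeftAdjoint := have := hZ.subobjects; isRightAdjoint_ι_inverseImage hZ.hasLeftAdjoint e

/-- Having enough closed subspaces is invariant under equivalence of categories. -/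
theorem HasEnoughClosedSubspaces.of_equivalence (h : HasEnoughClosedSubspaces C) (e : C ≌ D) :
    HasEnoughClosedSubspaces D := by
  intro M hM
  obtain ⟨Z, hZw, hZc⟩ := h _ (isNoetherianObject_functor_obj e.symm hM)
  have hle : ∀ W : ObjectProperty D, IsWeaklyClosed W → Z ≤ W.inverseImage e.functor →
      Z.inverseImage e.symm.functor ≤ W := fun W hW hZW N hN =>
    have := hW.subobjects
    W.prop_of_iso (e.counitIso.app N) (hZW _ hN)
  have hmem : ∀ W : ObjectProperty D, IsWeaklyClosed W → W M →
      W.inverseImage e.functor (e.symm.functor.obj M) := fun W hW hWM =>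
    have := hW.subobjects
    W.prop_of_iso (e.counitIso.app M).symm hWM
  exact ⟨Z.inverseImage e.symm.functor,
    ⟨⟨hZw.1.1.inverseImage e.symm, hZw.1.2⟩, fun W hW =>
      hle W hW.1 (hZw.2 ⟨hW.1.inverseImage e, hmem W hW.1 hW.2⟩)⟩,
    ⟨⟨hZc.1.1.inverseImage e.symm, hZc.1.2⟩, fun W hW =>
      hle W hW.1.1 (hZc.2 ⟨hW.1.inverseImage e, hmem W hW.1.1 hW.2⟩)⟩⟩

/-- The inclusion of a full subcategory has a right adjoint if every object has a largest subobject
in the subcategory. -/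
theorem isLeftAdjoint_ι_of_exists_mono {W : ObjectProperty C}
    (h : ∀ N : C, ∃ (A : C) (f : A ⟶ N), W A ∧ Mono f ∧
      ∀ (B : C) (g : B ⟶ N), W B → ∃ k, k ≫ f = g) : W.ι.IsLeftAdjoint := by
  have (N : C) : Limits.HasTerminal (CostructuredArrow W.ι N) := by
    obtain ⟨A, f, hA, _, hf⟩ := h N
    choose k hk using hf
    let f' : W.ι.obj ⟨A, hA⟩ ⟶ N := f
    refine Limits.IsTerminal.hasTerminal (X := CostructuredArrow.mk f')
      (.ofUniqueHom (fun X => CostructuredArrow.homMk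
        (ObjectProperty.homMk (k _ X.hom X.left.property))
        (hk _ X.hom X.left.property)) fun X m => ?_)
    apply CostructuredArrow.hom_ext
    apply ObjectProperty.hom_ext
    rw [← cancel_mono f]
    exact (CostructuredArrow.w m).trans (hk _ X.hom X.left.property).symm
  exact isLeftAdjoint_of_costructuredArrowTerminals _

/-- The inclusion of a full subcategory has a left adjoint if every object has a largest quotient
in the subcategory. -/
theorem isRightAdjoint_ι_of_exists_epi {W : ObjectProperty C}
    (h : ∀ N : C, ∃ (A : C) (f : N ⟶ A), W A ∧ Epi f ∧
      ∀ (B : C) (g : N ⟶ B), W B → ∃ k, f ≫ k = g) : W.ι.IsRightAdjoint := by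
  have (N : C) : Limits.HasInitial (StructuredArrow N W.ι) := by
    obtain ⟨A, f, hA, _, hf⟩ := h N
    choose k hk using hf
    let f' : N ⟶ W.ι.obj ⟨A, hA⟩ := f
    refine Limits.IsInitial.hasInitial (X := StructuredArrow.mk f')
      (.ofUniqueHom (fun X => StructuredArrow.homMk
        (ObjectProperty.homMk (k _ X.hom X.right.property))
        (hk _ X.hom X.right.property)) fun X m => ?_)
    apply StructuredArrow.hom_ext
    apply ObjectProperty.hom_ext
    rw [← cancel_epi f]
    exact (StructuredArrow.w m).trans (hk _ X.hom X.right.property).symm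
  exact isRightAdjointOfStructuredArrowInitials _

/-- The counit of the adjunction: maps to `N` from objects of the subcategory factor through a
single one. -/
theorem exists_factor_of_isLeftAdjoint {W : ObjectProperty C} (h : W.ι.IsLeftAdjoint) (N : C) :
    ∃ (A : C) (f : A ⟶ N), W A ∧ ∀ (B : C) (g : B ⟶ N), W B → ∃ k, k ≫ f = g := by
  let adj := Adjunction.ofIsLeftAdjoint W.ι
  refine ⟨_, adj.counit.app N, (W.ι.rightAdjoint.obj N).property, fun B g hB => ?_⟩
  let B' : W.FullSubcategory := ⟨B, hB⟩
  exact ⟨W.ι.map (adj.homEquiv B' N g), by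
    have := adj.homEquiv_counit (g := adj.homEquiv B' N g)
    rw [Equiv.symm_apply_apply] at this
    exact this.symm⟩

/-- The unit of the adjunction: maps from `N` to objects of the subcategory factor through a
single one. -/
theorem exists_factor_of_isRightAdjoint {W : ObjectProperty C} (h : W.ι.IsRightAdjoint) (N : C) :
    ∃ (A : C) (f : N ⟶ A), W A ∧ ∀ (B : C) (g : N ⟶ B), W B → ∃ k, f ≫ k = g := by
  let adj := Adjunction.ofIsRightAdjoint W.ι
  refine ⟨_, adj.unit.app N, (W.ι.leftAdjoint.obj N).property, fun B g hB => ?_⟩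
  let B' : W.FullSubcategory := ⟨B, hB⟩
  exact ⟨W.ι.map ((adj.homEquiv N B').symm g), by
    have := adj.homEquiv_unit (f := (adj.homEquiv N B').symm g)
    rw [Equiv.apply_symm_apply] at this
    exact this.symm⟩

end Transport

/-! ### Subspaces of a category of modules -/

section Modules

variable {S : Type u} [Ring S]

/-- A weakly closed subspace contains every module `N` each of whose elements lies in the image of
some module of the subspace. -/
theorem IsWeaklyClosed.prop_of_forall_exists_hom {W : ObjectProperty (ModuleCat.{u} S)}
    (hW : IsWeaklyClosed W) {N : ModuleCat.{u} S}
    (h : ∀ x : N, ∃ (B : ModuleCat.{u} S) (g : B ⟶ N), W B ∧ x ∈ LinearMap.range g.hom) : W N := by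
  obtain ⟨A, f, hA, hf⟩ := exists_factor_of_isLeftAdjoint hW.hasRightAdjoint N
  have : Epi f := (ModuleCat.epi_iff_surjective f).2 fun x => by
    obtain ⟨B, g, hB, y, rfl⟩ := h x
    obtain ⟨k, rfl⟩ := hf B g hB
    exact ⟨k.hom y, rfl⟩
  have := hW.quotients
  exact W.prop_of_epi f hA

theorem IsWeaklyClosed.prop_pi {W : ObjectProperty (ModuleCat.{u} S)} (hW : IsWeaklyClosed W)
    {M : ModuleCat.{u} S} (hM : W M) (ι : Type u) [Finite ι] :
    W (ModuleCat.of S (ι → M)) := by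
  classical
  have := Fintype.ofFinite ι
  obtain ⟨A, f, hA, hf⟩ :=
    exists_factor_of_isLeftAdjoint hW.hasRightAdjoint (ModuleCat.of S (ι → M))
  have : Epi f := (ModuleCat.epi_iff_range_eq_top f).2 (eq_top_iff.2 fun x _ => by
    rw [← Finset.univ_sum_single x]
    refine Submodule.sum_mem _ fun i _ => ?_
    obtain ⟨k, hk⟩ := hf M (ModuleCat.ofHom (LinearMap.single S (fun _ : ι => (M : Type u)) i)) hM
    exact ⟨k.hom (x i), congr($(hk).hom (x i))⟩)
  have := hW.quotients
  exact W.prop_of_epi f hA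

/-- A closed subspace contains every module `N` whose elements are separated by maps to modules of
the subspace. -/
theorem IsClosed.prop_of_forall_exists_hom {Z : ObjectProperty (ModuleCat.{u} S)}
    (hZ : IsClosed Z) {N : ModuleCat.{u} S}
    (h : ∀ x : N, x ≠ 0 → ∃ (B : ModuleCat.{u} S) (g : N ⟶ B), Z B ∧ g.hom x ≠ 0) : Z N := by
  obtain ⟨A, f, hA, hf⟩ := exists_factor_of_isRightAdjoint hZ.hasLeftAdjoint N
  have : Mono f := (ModuleCat.mono_iff_ker_eq_bot f).2 ((Submodule.eq_bot_iff _).2 fun x hx => by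
    by_contra hx0
    obtain ⟨B, g, hB, hg⟩ := h x hx0
    obtain ⟨k, rfl⟩ := hf B g hB
    refine hg ?_
    rw [ModuleCat.hom_comp, LinearMap.comp_apply, LinearMap.mem_ker.1 hx, map_zero])
  have := hZ.subobjects
  exact Z.prop_of_mono f hA

/-- The modules subgenerated by `M`, often denoted `σ[M]`. Their cyclic submodules are subquotients
of finite powers of `M`, which is expressed elementwise: the annihilator of each
element contains the common annihilator of finitely many elements of `M`. -/
def subgeneratedBy (M : ModuleCat.{u} S) : ObjectProperty (ModuleCat.{u} S) := fun N =>
  ∀ x : N, ∃ F : Finset M, ∀ s : S, (∀ m ∈ F, s • m = 0) → s • x = 0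

theorem subgeneratedBy_self (M : ModuleCat.{u} S) : subgeneratedBy M M := fun x =>
  ⟨{x}, fun _ hs => hs x (Finset.mem_singleton_self x)⟩

theorem isWeaklyClosed_subgeneratedBy (M : ModuleCat.{u} S) :
    IsWeaklyClosed (subgeneratedBy M) where
  subobjects := ⟨fun {X Y} f _ hY x => by
    obtain ⟨F, hF⟩ := hY (f.hom x)
    refine ⟨F, fun s hs => (ModuleCat.mono_iff_injective f).1 inferInstance ?_⟩
    simpa using hF s hs⟩
  quotients := ⟨fun {X Y} f _ hX y => by
    obtain ⟨x, rfl⟩ := (ModuleCat.epi_iff_surjective f).1 inferInstance y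
    obtain ⟨F, hF⟩ := hX x
    refine ⟨F, fun s hs => ?_⟩
    simpa using congrArg f.hom (hF s hs)⟩
  hasRightAdjoint := isLeftAdjoint_ι_of_exists_mono fun N => by
    classical
    let T : Submodule S N :=
      { carrier := {x | ∃ F : Finset M, ∀ s : S, (∀ m ∈ F, s • m = 0) → s • x = 0}
        zero_mem' := ⟨∅, fun s _ => smul_zero s⟩
        add_mem' := by
          rintro x y ⟨F, hF⟩ ⟨G, hG⟩
          refine ⟨F ∪ G, fun s hs => ?_⟩
          rw [smul_add, hF s fun m hm => hs m (Finset.mem_union_left _ hm),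
            hG s fun m hm => hs m (Finset.mem_union_right _ hm), add_zero]
        smul_mem' := by
          rintro r x ⟨F, hF⟩
          refine ⟨F.image (r • ·), fun s hs => ?_⟩
          rw [smul_smul]
          refine hF _ fun m hm => ?_
          rw [mul_smul]
          exact hs _ (Finset.mem_image_of_mem _ hm) }
    refine ⟨.of S T, ModuleCat.ofHom T.subtype, fun x => ?_,
      (ModuleCat.mono_iff_injective _).2 T.subtype_injective, fun B g hB => ?_⟩
    · obtain ⟨F, hF⟩ := x.2
      exact ⟨F, fun s hs => Subtype.ext (hF s hs)⟩
    · refine ⟨ModuleCat.ofHom (g.hom.codRestrict T fun b => ?_), rfl⟩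
      obtain ⟨F, hF⟩ := hB b
      exact ⟨F, fun s hs => by rw [← map_smul, hF s hs, map_zero]⟩

/-- A weakly closed subspace that contains `M` contains `subgeneratedBy M`: a cyclic module
`S x` with `⋂ Ann m ⊆ Ann x`, for `m` in a finite set `F`, is a quotient of the submodule of `M ^ F`
generated by the vector of the elements of `F`. -/
theorem IsWeaklyClosed.subgeneratedBy_le {W : ObjectProperty (ModuleCat.{u} S)}
    (hW : IsWeaklyClosed W) {M : ModuleCat.{u} S} (hM : W M) : subgeneratedBy M ≤ W := by
  intro N hN
  refine hW.prop_of_forall_exists_hom fun x => ?_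
  obtain ⟨F, hF⟩ := hN x
  let φ : S →ₗ[S] (F → M) := LinearMap.toSpanSingleton S (F → M) Subtype.val
  have hker : LinearMap.ker φ ≤ LinearMap.ker (LinearMap.toSpanSingleton S N x) := fun s hs => by
    refine hF s fun m hm => ?_
    exact congrFun (LinearMap.mem_ker.1 hs) ⟨m, hm⟩
  let ψ : (S ⧸ LinearMap.ker φ) →ₗ[S] N := Submodule.liftQ _ _ hker
  have := hW.subobjects
  refine ⟨.of S (S ⧸ LinearMap.ker φ), ModuleCat.ofHom ψ, ?_, Submodule.Quotient.mk 1, ?_⟩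
  · let θ : ModuleCat.of S (S ⧸ LinearMap.ker φ) ⟶ ModuleCat.of S (F → M) :=
      ModuleCat.ofHom ((LinearMap.ker φ).liftQ φ le_rfl)
    have : Mono θ := (ModuleCat.mono_iff_ker_eq_bot θ).2 (Submodule.ker_liftQ_eq_bot' _ φ rfl)
    exact W.prop_of_mono θ (hW.prop_pi hM F)
  · exact one_smul S x

/-- The modules annihilated by a given left ideal. For a two-sided ideal `A` these are the
modules over `S ⧸ A`. -/
def annihilatedBy (A : Ideal S) : ObjectProperty (ModuleCat.{u} S) := fun N =>
  A ≤ Module.annihilator S N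

theorem isClosed_annihilatedBy (A : Ideal S) : IsClosed (annihilatedBy A) where
  subobjects := ⟨fun {X Y} f _ hY s hs => Module.mem_annihilator.2 fun x =>
    (ModuleCat.mono_iff_injective f).1 inferInstance (by
      simpa using Module.mem_annihilator.1 (hY hs) (f.hom x))⟩
  quotients := ⟨fun {X Y} f _ hX s hs => Module.mem_annihilator.2 fun y => by
    obtain ⟨x, rfl⟩ := (ModuleCat.epi_iff_surjective f).1 inferInstance y
    simpa using congrArg f.hom (Module.mem_annihilator.1 (hX hs) x)⟩
  hasRightAdjoint := isLeftAdjoint_ι_of_exists_mono fun N => by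
    let T : Submodule S N :=
      { carrier := {x | ∀ s ∈ A, ∀ t : S, s • t • x = 0}
        zero_mem' := by simp
        add_mem' := fun {x y} hx hy s hs t => by
          rw [smul_add, smul_add, hx s hs, hy s hs, add_zero]
        smul_mem' := fun r x hx s hs t => by
          rw [smul_smul t r]
          exact hx s hs _ }
    refine ⟨.of S T, ModuleCat.ofHom T.subtype, fun s hs => Module.mem_annihilator.2 fun x => ?_,
      (ModuleCat.mono_iff_injective _).2 T.subtype_injective, fun B g hB => ?_⟩
    · exact Subtype.ext (by simpa using x.2 s hs 1)
    · refine ⟨ModuleCat.ofHom (g.hom.codRestrict T fun b s hs t => ?_), rfl⟩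
      rw [← map_smul, ← map_smul, Module.mem_annihilator.1 (hB hs), map_zero]
  hasLeftAdjoint := isRightAdjoint_ι_of_exists_epi fun N => by
    let T : Submodule S N := Submodule.span S {y | ∃ s ∈ A, ∃ x : N, y = s • x}
    refine ⟨.of S (N ⧸ T), ModuleCat.ofHom T.mkQ, fun s hs => Module.mem_annihilator.2 fun x => ?_,
      (ModuleCat.epi_iff_surjective _).2 T.mkQ_surjective, fun B g hB => ?_⟩
    · obtain ⟨y, rfl⟩ := Submodule.Quotient.mk_surjective T x
      rw [← Submodule.Quotient.mk_smul, Submodule.Quotient.mk_eq_zero]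
      exact Submodule.subset_span ⟨s, hs, y, rfl⟩
    · refine ⟨ModuleCat.ofHom (T.liftQ g.hom (Submodule.span_le.2 ?_)), rfl⟩
      rintro _ ⟨s, hs, x, rfl⟩
      rw [SetLike.mem_coe, LinearMap.mem_ker, map_smul, Module.mem_annihilator.1 (hB hs)]

theorem exists_annihilator_eq_iff (M : ModuleCat.{u} S) :
    (∃ F : Finset M, Module.annihilator S M = ⨅ m ∈ F, Ideal.torsionOf S M m) ↔
      ∃ F : Finset M, ∀ s : S, (∀ m ∈ F, s • m = 0) → s ∈ Module.annihilator S M := by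
  refine exists_congr fun F => ⟨fun h s hs => ?_, fun h => le_antisymm
    (le_iInf₂ fun m _ => annihilator_le_torsionOf m) fun s hs => h s ?_⟩
  · simpa [h, Submodule.mem_iInf, Ideal.mem_torsionOf_iff] using hs
  · simpa [Submodule.mem_iInf, Ideal.mem_torsionOf_iff] using hs

/-- The subspace generated by `M` is closed if and only if it contains `S ⧸ Ann M`, which lies in
every closed subspace that contains `M`. -/
theorem exists_isWeakSupport_and_isSupport_iff (M : ModuleCat.{u} S) :
    (∃ Z, IsWeakSupport M Z ∧ IsSupport M Z) ↔
      ∃ F : Finset M, Module.annihilator S M = ⨅ m ∈ F, Ideal.torsionOf S M m := by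
  rw [exists_annihilator_eq_iff]
  constructor
  · rintro ⟨Z, hZw, hZ⟩
    have hle : Z ≤ subgeneratedBy M :=
      hZw.2 ⟨isWeaklyClosed_subgeneratedBy M, subgeneratedBy_self M⟩
    have hmem : Z (ModuleCat.of S (S ⧸ Module.annihilator S M)) :=
      hZ.1.1.prop_of_forall_exists_hom fun x hx => by
        obtain ⟨s, rfl⟩ := Submodule.Quotient.mk_surjective _ x
        rw [Ne, Submodule.Quotient.mk_eq_zero, Module.mem_annihilator] at hx
        push Not at hx
        obtain ⟨m, hm⟩ := hx
        exact ⟨M, ModuleCat.ofHom (Submodule.liftQ _ (LinearMap.toSpanSingleton S M m)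
          (annihilator_le_torsionOf m)), hZ.1.2, hm⟩
    -- The annihilator of the element `1` of `S ⧸ Ann M` is `Ann M`.
    obtain ⟨F, hF⟩ := hle _ hmem (Submodule.Quotient.mk 1)
    refine ⟨F, fun s hs => ?_⟩
    have := hF s hs
    rw [← Submodule.Quotient.mk_smul] at this
    simpa using (Submodule.Quotient.mk_eq_zero _).1 this
  · rintro ⟨F, hF⟩
    have heq : subgeneratedBy M = annihilatedBy (Module.annihilator S M) := by
      refine le_antisymm ((isClosed_annihilatedBy _).subgeneratedBy_le le_rfl) ?_
      exact fun N hN x => ⟨F, fun s hs => Module.mem_annihilator.1 (hN (hF s hs)) x⟩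
    refine ⟨subgeneratedBy M,
      ⟨⟨isWeaklyClosed_subgeneratedBy M, subgeneratedBy_self M⟩,
        fun W hW => hW.1.subgeneratedBy_le hW.2⟩,
      ⟨⟨heq ▸ isClosed_annihilatedBy _, subgeneratedBy_self M⟩,
        fun W hW => hW.1.subgeneratedBy_le hW.2⟩⟩

theorem isNoetherianObject_iff_isNoetherian (M : ModuleCat.{u} S) :
    IsNoetherianObject M ↔ IsNoetherian S M := by
  rw [isNoetherian_iff']
  exact (isNoetherianObject.is_iff _).trans ⟨fun (_ : WellFoundedGT (Subobject M)) =>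
    (ModuleCat.subobjectModule M).symm.strictMono.wellFoundedGT,
    fun _ => (ModuleCat.subobjectModule M).strictMono.wellFoundedGT⟩

/-- A ring is left noetherian if its modules have a separating family of noetherian modules: the
ring is the sum of the images of these, and its unit lies in a finite partial sum. -/
theorem isNoetherianRing_of_isSeparating {P : ObjectProperty (ModuleCat.{u} S)}
    (hP : P.IsSeparating) (h : ∀ G, P G → IsNoetherian S G) : IsNoetherianRing S := by
  let ι := Σ G : {G : ModuleCat.{u} S // P G}, (G.1 →ₗ[S] S)
  let T : Submodule S S := ⨆ i : ι, LinearMap.range i.2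
  have hT : T.mkQ = 0 := by
    have : (ModuleCat.ofHom T.mkQ) = 0 := hP _ _ fun G hG g => by
      ext x
      have : g.hom x ∈ T := Submodule.mem_iSup_of_mem (p := fun i : ι => LinearMap.range i.2)
        ⟨⟨G, hG⟩, g.hom⟩ ⟨x, rfl⟩
      simpa using this
    exact congr($(this).hom)
  have h1 : (1 : S) ∈ T := by
    rw [← Submodule.Quotient.mk_eq_zero, ← Submodule.mkQ_apply, hT, LinearMap.zero_apply]
  obtain ⟨F, hF⟩ := Submodule.mem_iSup_iff_exists_finset.1 h1
  have : ∀ i : ι, IsNoetherian S (LinearMap.range i.2) := fun i =>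
    have := h i.1.1 i.1.2
    inferInstance
  have hN : IsNoetherian S ↥(⨆ i ∈ F, LinearMap.range (i : ι).2) := by
    rw [iSup_subtype']
    exact isNoetherian_iSup
  rw [(Ideal.eq_top_iff_one _).2 hF] at hN
  exact (isNoetherian_top_iff).1 hN

end Modules

/-! ### Prime ideals and indecomposable injective modules -/

section Primes

variable {R : Type u} [Ring R]

/-- A two-sided ideal of `R`, viewed as a left ideal of `Rᵐᵒᵖ`. -/
def opIdeal (P : TwoSidedIdeal R) : Ideal Rᵐᵒᵖ := TwoSidedIdeal.asIdeal P.op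

theorem mem_opIdeal {P : TwoSidedIdeal R} {x : Rᵐᵒᵖ} : x ∈ opIdeal P ↔ x.unop ∈ P := by
  rw [opIdeal, TwoSidedIdeal.mem_asIdeal, TwoSidedIdeal.mem_op_iff]

theorem op_mem_opIdeal {P : TwoSidedIdeal R} {r : R} : op r ∈ opIdeal P ↔ r ∈ P := mem_opIdeal

theorem opIdeal_injective : Function.Injective (opIdeal (R := R)) := fun P P' h => by
  ext r
  rw [← op_mem_opIdeal, h, op_mem_opIdeal]

/-- The two-sided ideal of all `x` such that `x R y ⊆ P` for all `y` in the set `T`. -/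
def leftTransporter (P : TwoSidedIdeal R) (T : Set R) : TwoSidedIdeal R :=
  .mk' {x | ∀ y ∈ T, ∀ s, x * s * y ∈ P}
    (fun y _ s => by simp [P.zero_mem])
    (fun hx hy z hz s => by
      rw [add_mul, add_mul]
      exact P.add_mem (hx z hz s) (hy z hz s))
    (fun hx z hz s => by
      rw [neg_mul, neg_mul]
      exact P.neg_mem (hx z hz s))
    (fun {r x} hx z hz s => by
      rw [mul_assoc r, mul_assoc r]
      exact P.mul_mem_left _ _ (hx z hz s))
    (fun {x r} hx z hz s => by
      rw [mul_assoc x]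
      exact hx z hz _)

theorem mem_leftTransporter {P : TwoSidedIdeal R} {T : Set R} {x : R} :
    x ∈ leftTransporter P T ↔ ∀ y ∈ T, ∀ s, x * s * y ∈ P := by
  rw [leftTransporter, TwoSidedIdeal.mem_mk']
  rfl

/-- The two-sided ideal of all `y` such that `x R y ⊆ P` for all `x` in the set `T`. -/
def rightTransporter (P : TwoSidedIdeal R) (T : Set R) : TwoSidedIdeal R :=
  .mk' {y | ∀ x ∈ T, ∀ s, x * s * y ∈ P}
    (fun y _ s => by simp [P.zero_mem])
    (fun hx hy z hz s => by
      rw [mul_add]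
      exact P.add_mem (hx z hz s) (hy z hz s))
    (fun hx z hz s => by
      rw [mul_neg]
      exact P.neg_mem (hx z hz s))
    (fun {r y} hy z hz s => by
      rw [← mul_assoc, mul_assoc z]
      exact hy z hz _)
    (fun {y r} hy z hz s => by
      rw [← mul_assoc]
      exact P.mul_mem_right _ _ (hy z hz s))

theorem mem_rightTransporter {P : TwoSidedIdeal R} {T : Set R} {y : R} :
    y ∈ rightTransporter P T ↔ ∀ x ∈ T, ∀ s, x * s * y ∈ P := by
  rw [rightTransporter, TwoSidedIdeal.mem_mk']
  rfl

theorem isTwoSidedPrime_opIdeal_iff {P : TwoSidedIdeal R} :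
    IsTwoSidedPrime (opIdeal P) ↔ IsPrimeIdeal P := by
  constructor
  · refine fun h => ⟨fun hP => h.one_notMem ?_, fun I J hIJ => ?_⟩
    · rw [mem_opIdeal, hP]
      trivial
    · by_contra! hc
      obtain ⟨a, ha, haP⟩ := SetLike.not_le_iff_exists.1 hc.1
      obtain ⟨b, hb, hbP⟩ := SetLike.not_le_iff_exists.1 hc.2
      -- Multiplication in `Rᵐᵒᵖ` is reversed, so that `b` comes before `a`.
      refine (h.mem_or_mem (a := op b) (b := op a) fun s => mem_opIdeal.2 ?_).elim
        (fun h => hbP (mem_opIdeal.1 h)) (fun h => haP (mem_opIdeal.1 h))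
      exact hIJ a ha _ (J.mul_mem_left s.unop _ hb)
  · refine fun h => ⟨fun {a} s ha => ?_, fun h1 => h.1 ?_, fun {a b} hab => ?_⟩
    · exact mem_opIdeal.2 (P.mul_mem_left _ _ (mem_opIdeal.1 ha))
    · exact (TwoSidedIdeal.one_mem_iff P).1 (mem_opIdeal.1 h1)
    · let I := leftTransporter P {a.unop}
      have hb : b.unop ∈ I := mem_leftTransporter.2 fun y hy s => by
        rw [Set.mem_singleton_iff.1 hy, mul_assoc]
        exact mem_opIdeal.1 (hab (op s))
      have ha : a.unop ∈ rightTransporter P (I : Set R) := mem_rightTransporter.2 fun x hx s =>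
        mem_leftTransporter.1 hx _ rfl s
      refine (h.2 I (rightTransporter P I) fun x hx y hy => ?_).symm.imp (fun hle => ?_)
        (fun hle => ?_)
      · simpa using mem_rightTransporter.1 hy x hx 1
      · exact mem_opIdeal.2 (hle ha)
      · exact mem_opIdeal.2 (hle hb)

theorem IsTwoSidedPrime.exists_opIdeal_eq {Q : Ideal Rᵐᵒᵖ} (h : IsTwoSidedPrime Q) :
    ∃ P : TwoSidedIdeal R, IsPrimeIdeal P ∧ opIdeal P = Q := by
  let P : TwoSidedIdeal R := .mk' {r | op r ∈ Q} Q.zero_mem (fun hx hy => Q.add_mem hx hy)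
    (fun hx => Q.neg_mem hx) (fun {r x} hx => h.mul_mem_right (op r) hx)
    (fun {x r} hx => Q.mul_mem_left (op r) hx)
  have hP : opIdeal P = Q := by
    ext x
    rw [mem_opIdeal, TwoSidedIdeal.mem_mk']
    rfl
  exact ⟨P, isTwoSidedPrime_opIdeal_iff.1 (hP ▸ h), hP⟩

theorem isAssociated_iff {P : TwoSidedIdeal R} {E : Type u} [AddCommGroup E] [Module Rᵐᵒᵖ E] :
    IsAssociated P E ↔ ∃ N : Submodule Rᵐᵒᵖ E, IsPrimeSubmodule (opIdeal P) N := by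
  refine exists_congr fun N => ⟨fun ⟨⟨hN, h⟩, hP⟩ => ?_,
    fun h => ⟨⟨?_, fun K hK => ?_⟩, fun r => ?_⟩⟩
  · refine ⟨Submodule.nontrivial_iff_ne_bot.1 hN, fun x hx hx0 s => ?_⟩
    have hK := h (Submodule.span Rᵐᵒᵖ {⟨x, hx⟩}) (by simpa using hx0)
    rw [mem_opIdeal, hP, op_unop, ← hK, mem_annihilator_span_singleton]
    simp only [Subtype.ext_iff]
    rfl
  · exact Submodule.nontrivial_iff_ne_bot.2 h.1
  · refine le_antisymm (fun s hs => ?_) fun s hs => ?_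
    · have hsQ := h.top.mem_of_forall_smul_eq_zero le_top hK fun x hx =>
        congrArg Subtype.val (Module.mem_annihilator.1 hs ⟨x, hx⟩)
      exact Module.mem_annihilator.2 fun x => Subtype.ext (h.smul_eq_zero hsQ x.2)
    · exact Module.mem_annihilator.2 fun x =>
        Subtype.ext (Module.mem_annihilator.1 hs x.1)
  · rw [← op_mem_opIdeal, Module.mem_annihilator]
    refine ⟨fun hr x => Subtype.ext (h.smul_eq_zero hr x.2), fun hr => ?_⟩
    exact h.mem_of_forall_smul_eq_zero le_rfl h.1 fun x hx => congrArg Subtype.val (hr ⟨x, hx⟩)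

theorem injective_indecomposable_iff {E : ModuleCat.{u} Rᵐᵒᵖ} :
    (Injective E ∧ Indecomposable E) ↔
      Module.Injective Rᵐᵒᵖ E ∧ IsUniformSubmodule (⊤ : Submodule Rᵐᵒᵖ E) := by
  have h : Module.Injective Rᵐᵒᵖ E ↔ Injective E := Module.injective_iff_injective_object Rᵐᵒᵖ E
  refine ⟨fun ⟨hE, hi⟩ => ?_, fun ⟨hE, hu⟩ =>
    ⟨h.1 hE, indecomposable_of_isUniformSubmodule_top hu⟩⟩
  have := h.2 hE
  exact ⟨this, isUniformSubmodule_top_of_indecomposable hi⟩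

theorem isIsomorphic_indecInj_iff {E E' : IndecInj R} :
    IsIsomorphic E E' ↔ Nonempty (E.obj ≃ₗ[Rᵐᵒᵖ] E'.obj) :=
  ⟨fun ⟨i⟩ => ⟨((ObjectProperty.ι _).mapIso i).toLinearEquiv⟩,
    fun ⟨e⟩ => ⟨(ObjectProperty.fullyFaithfulι _).preimageIso e.toModuleIso⟩⟩

/-- An indecomposable injective module over a noetherian ring has exactly one associated prime. -/
theorem existsUnique_isAssociated [IsNoetherianRing Rᵐᵒᵖ] (E : IndecInj R) :
    ∃! P : PrimeIdeals R, IsAssociated P.1 E.obj := by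
  have hE := (injective_indecomposable_iff.1 E.property).2
  obtain ⟨Q, N, -, hN⟩ := exists_isPrimeSubmodule_le hE.1
  obtain ⟨P, hP, rfl⟩ := hN.isTwoSidedPrime.exists_opIdeal_eq
  refine ⟨⟨P, hP⟩, isAssociated_iff.2 ⟨N, hN⟩, fun P' hP' => Subtype.ext (opIdeal_injective ?_)⟩
  obtain ⟨N', hN'⟩ := isAssociated_iff.1 hP'
  exact hN'.eq_of_inf_ne_bot hN (hE.2 _ le_top _ le_top hN'.1 hN.1)

/-- Each prime ideal `P` is associated to an indecomposable injective module, the hull of a uniform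
right ideal of `R ⧸ P`. -/
theorem exists_isAssociated [IsNoetherianRing Rᵐᵒᵖ] (P : PrimeIdeals R) :
    ∃ E : IndecInj R, IsAssociated P.1 E.obj := by
  have hP := (isTwoSidedPrime_opIdeal_iff.2 P.2).isPrimeSubmodule_top
  obtain ⟨V, hVT, hV⟩ := exists_isUniformSubmodule_le hP.1
  obtain ⟨E, i, -, hE, hu, hp⟩ := exists_injective_isPrimeSubmodule hV (hP.mono hVT hV.1)
  exact ⟨⟨E, injective_indecomposable_iff.2 ⟨hE, hu⟩⟩, isAssociated_iff.2 ⟨_, hp⟩⟩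

theorem IsAssociated.of_linearEquiv {P : TwoSidedIdeal R} {E E' : Type u} [AddCommGroup E]
    [Module Rᵐᵒᵖ E] [AddCommGroup E'] [Module Rᵐᵒᵖ E'] (h : IsAssociated P E)
    (e : E ≃ₗ[Rᵐᵒᵖ] E') : IsAssociated P E' := by
  obtain ⟨N, hN⟩ := isAssociated_iff.1 h
  exact isAssociated_iff.2 ⟨_, hN.map e.toLinearMap e.injective⟩

theorem primesBijectIndecInj_iff [IsNoetherianRing Rᵐᵒᵖ] :
    PrimesBijectIndecInj R ↔ UniqueHullOverPrime Rᵐᵒᵖ := by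
  constructor
  · rintro ⟨Φ, hΦ⟩ E E' hE hE' hu hu' Q N N' hN hN'
    obtain ⟨P, hP, rfl⟩ := hN.isTwoSidedPrime.exists_opIdeal_eq
    let X : IndecInj R := ⟨E, injective_indecomposable_iff.2 ⟨hE, hu⟩⟩
    let X' : IndecInj R := ⟨E', injective_indecomposable_iff.2 ⟨hE', hu'⟩⟩
    have h := (hΦ ⟨P, hP⟩ X).2 (isAssociated_iff.2 ⟨N, hN⟩)
    have h' := (hΦ ⟨P, hP⟩ X').2 (isAssociated_iff.2 ⟨N', hN'⟩)
    exact isIsomorphic_indecInj_iff.1 (Quotient.exact (h.symm.trans h'))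
  · intro h
    choose p hp hp' using existsUnique_isAssociated (R := R)
    let Ψ : IndecInjClasses R → PrimeIdeals R := Quotient.lift p fun E E' hEE' => by
      obtain ⟨e⟩ := isIsomorphic_indecInj_iff.1 hEE'
      exact hp' E' _ ((hp E).of_linearEquiv e)
    have hΨ : Function.Bijective Ψ := by
      refine ⟨?_, fun P => ?_⟩
      · rintro ⟨E⟩ ⟨E'⟩ (hEE' : p E = p E')
        obtain ⟨N, hN⟩ := isAssociated_iff.1 (hp E)
        obtain ⟨N', hN'⟩ := isAssociated_iff.1 (hp E')
        rw [← hEE'] at hN'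
        have hE := injective_indecomposable_iff.1 E.property
        have hE' := injective_indecomposable_iff.1 E'.property
        exact Quotient.sound (isIsomorphic_indecInj_iff.2
          (h E.obj E'.obj hE.1 hE'.1 hE.2 hE'.2 _ N N' hN hN'))
      · obtain ⟨E, hE⟩ := exists_isAssociated P
        exact ⟨Quotient.mk _ E, (hp' E P hE).symm⟩
    refine ⟨(Equiv.ofBijective Ψ hΨ).symm, fun P E => ?_⟩
    rw [Equiv.symm_apply_eq]
    exact ⟨fun hP => hP ▸ hp E, fun hP => hp' E P hP⟩

end Primes

/-! ### The affine space with coordinate ring `R` -/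

section Affine

variable {R : Type u} [Ring R]

theorem isNoetherianRing_of_isLocallyNoetherian {C : Type w} [Category.{v} C]
    (hC : IsLocallyNoetherian.{u} C) (e : C ≌ ModuleCat.{u} Rᵐᵒᵖ) : IsNoetherianRing Rᵐᵒᵖ := by
  obtain ⟨P, -, hP, hN⟩ := hC
  refine isNoetherianRing_of_isSeparating (hP.of_equivalence e) ?_
  rintro _ ⟨G, hG⟩
  exact (isNoetherianObject_iff_isNoetherian _).1 (isNoetherianObject_functor_obj e (hN G hG))

theorem hasEnoughClosedSubspaces_moduleCat_iff :
    HasEnoughClosedSubspaces (ModuleCat.{u} Rᵐᵒᵖ) ↔ ConditionH R := by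
  refine ⟨fun h M _ _ hM => ?_, fun h M hM => ?_⟩
  · exact (exists_isWeakSupport_and_isSupport_iff (ModuleCat.of Rᵐᵒᵖ M)).1
      (h _ ((isNoetherianObject_iff_isNoetherian _).2 hM))
  · exact (exists_isWeakSupport_and_isSupport_iff M).2
      (h M ((isNoetherianObject_iff_isNoetherian M).1 hM))

end Affine

end NCSpace

theorem mainTheorem4 (C : Type w) [Category.{v} C] [Abelian C] [IsGrothendieckAbelian.{u} C]
    (hC : NCSpace.IsLocallyNoetherian.{u} C)
    (R : Type u) [Ring R] (hR : NCSpace.IsCoordinateRing R C) :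
    List.TFAE [NCSpace.HasEnoughClosedSubspaces C,
      NCSpace.ConditionH R,
      NCSpace.PrimesBijectIndecInj R] := by
  obtain ⟨e⟩ := hR
  have := NCSpace.isNoetherianRing_of_isLocallyNoetherian hC e
  tfae_have 1 ↔ 2 := ⟨
    fun h => NCSpace.hasEnoughClosedSubspaces_moduleCat_iff.1 (h.of_equivalence e),
    fun h => (NCSpace.hasEnoughClosedSubspaces_moduleCat_iff.2 h).of_equivalence e.symm⟩
  tfae_have 2 ↔ 3 := by
    rw [NCSpace.primesBijectIndecInj_iff]
    exact ⟨NCSpace.uniqueHullOverPrime_of_exists_annihilator_eq,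
      fun h M _ _ _ => h.exists_annihilator_eq M⟩
  tfae_finish
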